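/- Let $d\in\{2,3\}$, let $\Omega\subset\mathbb R^d$ be a bounded Lipschitz domain with outward unit normal $\nu$, and let $\alpha,R,K,D>0$ and $k\ge 0$ be constants, $\mu(c)=e^{Rc}$, $\rho(c)=1+\alpha c$. Let $\boldsymbol g\in L^\infty(\Omega)^d$, let $\kappa\in L^2(\Omega)$ (for instance $\kappa$ bounded) satisfy $\kappa(x)\ge\kappa_1$ for a.e. $x\in\Omega$ with a constant $\kappa_1>0$, and let $c_0$ be measurable with $0\le c_0\le M_2$ a.e. in $\Omega$. Consider, on $(0,\infty)\times\Omega$, the system $$\nabla\cdot\boldsymbol u=0,\qquad \frac{\mu(c)}{K}\boldsymbol u=-\nabla p-\rho(c)\boldsymbol g,\qquad (1+k)\frac{\partial c}{\partial t}+\nabla\cdot(c\,\boldsymbol u)=D\Delta c-\kappa c,$$ with $\boldsymbol u\cdot\nu=0$ and $\nabla c\cdot\nu=0$ on $\partial\Omega$ and $c(0)=c_0$. Let $\boldsymbol H$ be the space of $\boldsymbol v\in L^2(\Omega)^d$ with $\nabla\cdot\boldsymbol v=0$ in $\Omega$ and $\boldsymbol v\cdot\nu=0$ on $\partial\Omega$.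 A weak solution is a pair $(c,\boldsymbol u)$ with $c\in L^\infty(0,\infty;L^\infty(\Omega))\cap L^2(0,\infty;H^1(\Omega))$, $\boldsymbol u\in L^2(0,\infty;\boldsymbol H)\cap L^2(0,\infty;L^p(\Omega)^d)$ (for all $p\in[2,\infty)$ if $d=2$, for all $p\in[2,6]$ if $d=3$), $\partial_t c\in L^r(0,T;(H^1(\Omega))^*)$ for every finite $T>0$ ($r=2$ if $d=2$, $r=4/3$ if $d=3$), with $c(0)=c_0$ in $L^2(\Omega)$, such that for a.e. $t>0$ $$\Big(\tfrac{\mu(c)}{K}\boldsymbol u,\boldsymbol v\Big)+\big((1+\alpha c)\boldsymbol g,\boldsymbol v\big)=0\quad\forall\,\boldsymbol v\in\boldsymbol H,$$ $$(1+k)\langle\partial_t c,\phi\rangle-(c\,\boldsymbol u,\nabla\phi)+D(\nabla c,\nabla\phi)+(\kappa c,\phi)=0\quad\forall\,\phi\in H^1(\Omega),$$ where $(\cdot,\cdot)$ is the $L^2(\Omega)$ inner product. Here $c$ denotes its representative with values in $L^2(\Omega)$ that is continuous on $[0,\infty)$ when tested against $H^1(\Omega)$, so that $c(t)$ is defined for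 every $t\ge0$. Then, with $\lambda=\kappa_1/(1+k)>0$, there are constants $C_p>0$ $(1\le p\le\infty)$, independent of $c_0$, of the solution and of $t$, such that every weak solution $(c,\boldsymbol u)$ satisfies $$\|c(t)\|_{L^p(\Omega)}\le C_p\,e^{-\lambda t}\,\|c_0\|_{L^p(\Omega)}\qquad\text{for all } t\ge 0\text{ and all } p\in[1,\infty].$$ -/

import Mathlib

open MeasureTheory Set
open scoped ENNReal NNReal

namespace DensityFlow

/-- Physical space `ℝ^d` with its Euclidean norm. -/
abbrev Space (d : ℕ) : Type := EuclideanSpace ℝ (Fin d)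

variable {d : ℕ}

/-- `Ω` is a bounded Lipschitz domain: open, connected, non-empty, bounded, and near every boundary
point it is the region lying strictly above the graph of a Lipschitz function over a hyperplane
(`e` is the unit vector giving the upward direction, `x - ⟪e, x⟫ e` is the horizontal part
of `x`). -/
structure IsBoundedLipschitzDomain (Ω : Set (Space d)) : Prop where
  isOpen : IsOpen Ω
  isConnected : IsConnected Ω
  isBounded : Bornology.IsBounded Ω
  lipschitz_boundary : ∀ x₀ ∈ frontier Ω, ∃ (e : Space d) (r : ℝ) (L : ℝ≥0) (γ : Space d → ℝ),
    ‖e‖ = 1 ∧ 0 < r ∧ LipschitzWith L γ ∧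
      ∀ x ∈ Metric.ball x₀ r, x ∈ Ω ↔ γ (x - inner ℝ e x • e) < inner ℝ e x

/-- The scalar space `L²(Ω)`. -/
abbrev L2 (Ω : Set (Space d)) : Type := Lp ℝ 2 (volume.restrict Ω)

/-- The space `(L²(Ω))^d` of square-integrable vector fields. -/
abbrev L2Vec (Ω : Set (Space d)) : Type := Lp (Space d) 2 (volume.restrict Ω)

/-- `φ ∈ C_c^∞(Ω)`. -/
def IsTestFunction (Ω : Set (Space d)) (φ : Space d → ℝ) : Prop :=
  ContDiff ℝ (⊤ : ℕ∞) φ ∧ HasCompactSupport φ ∧ tsupport φ ⊆ Ω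

/-- `G` is the weak gradient of `f` in `Ω`:
`∫_Ω f ∂_e φ = - ∫_Ω (G · e) φ` for all directions `e` and all `φ ∈ C_c^∞(Ω)`. -/
def HasWeakGradient (Ω : Set (Space d)) (f : L2 Ω) (G : L2Vec Ω) : Prop :=
  ∀ φ : Space d → ℝ, IsTestFunction Ω φ → ∀ e : Space d,
    ∫ x in Ω, f x * fderiv ℝ φ x e = -∫ x in Ω, inner ℝ (G x) e * φ x

/-- `q` is the weak divergence of `v` in `Ω`:
`∫_Ω v · ∇φ = - ∫_Ω q φ` for all `φ ∈ C_c^∞(Ω)`. -/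
def HasWeakDivergence (Ω : Set (Space d)) (v : L2Vec Ω) (q : L2 Ω) : Prop :=
  ∀ φ : Space d → ℝ, IsTestFunction Ω φ →
    ∫ x in Ω, fderiv ℝ φ x (v x) = -∫ x in Ω, q x * φ x

theorem integrable_mul_of_cont {Ω : Set (Space d)} (f : L2 Ω) {ψ : Space d → ℝ}
    (hψ : Continuous ψ) (hc : HasCompactSupport ψ) :
    Integrable (fun x => f x * ψ x) (volume.restrict Ω) :=
  MemLp.integrable_mul (p := 2) (q := 2) (Lp.memLp f) (hψ.memLp_of_hasCompactSupport hc)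

theorem integrable_inner_mul_of_cont {Ω : Set (Space d)} (G : L2Vec Ω) (e : Space d)
    {ψ : Space d → ℝ} (hψ : Continuous ψ) (hc : HasCompactSupport ψ) :
    Integrable (fun x => inner ℝ (G x) e * ψ x) (volume.restrict Ω) :=
  MemLp.integrable_mul (p := 2) (q := 2) ((Lp.memLp G).inner_const e)
    (hψ.memLp_of_hasCompactSupport hc)

theorem IsTestFunction.continuous_fderiv_apply {Ω : Set (Space d)} {φ : Space d → ℝ}
    (h : IsTestFunction Ω φ) (e : Space d) : Continuous fun x => fderiv ℝ φ x e :=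
  (h.1.continuous_fderiv (by simp)).clm_apply continuous_const

theorem HasWeakGradient.zero (Ω : Set (Space d)) : HasWeakGradient Ω 0 0 := by
  intro φ _ e
  have h1 : ∫ x in Ω, (0 : L2 Ω) x * fderiv ℝ φ x e = 0 := by
    rw [integral_congr_ae (g := fun _ => (0 : ℝ)), integral_zero]
    filter_upwards [Lp.coeFn_zero ℝ 2 (volume.restrict Ω)] with x hx
    simp only [hx, Pi.zero_apply, zero_mul]
  have h2 : ∫ x in Ω, inner ℝ ((0 : L2Vec Ω) x) e * φ x = 0 := by
    rw [integral_congr_ae (g := fun _ => (0 : ℝ)), integral_zero]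
    filter_upwards [Lp.coeFn_zero (Space d) 2 (volume.restrict Ω)] with x hx
    simp only [hx, Pi.zero_apply, zero_mul, inner_zero_left]
  rw [h1, h2, neg_zero]

theorem HasWeakGradient.add {Ω : Set (Space d)} {f₁ f₂ : L2 Ω} {G₁ G₂ : L2Vec Ω}
    (h₁ : HasWeakGradient Ω f₁ G₁) (h₂ : HasWeakGradient Ω f₂ G₂) :
    HasWeakGradient Ω (f₁ + f₂) (G₁ + G₂) := by
  intro φ hφ e
  have hd := hφ.continuous_fderiv_apply e
  have hdc : HasCompactSupport fun x => fderiv ℝ φ x e := hφ.2.1.fderiv_apply ℝ e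
  have e1 : ∫ x in Ω, (f₁ + f₂ : L2 Ω) x * fderiv ℝ φ x e
      = ∫ x in Ω, (f₁ x * fderiv ℝ φ x e + f₂ x * fderiv ℝ φ x e) := by
    refine integral_congr_ae ?_
    filter_upwards [Lp.coeFn_add f₁ f₂] with x hx
    simp only [hx, Pi.add_apply, add_mul]
  have e2 : ∫ x in Ω, inner ℝ ((G₁ + G₂ : L2Vec Ω) x) e * φ x
      = ∫ x in Ω, (inner ℝ (G₁ x) e * φ x + inner ℝ (G₂ x) e * φ x) := by
    refine integral_congr_ae ?_
    filter_upwards [Lp.coeFn_add G₁ G₂] with x hx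
    simp only [hx, Pi.add_apply, add_mul, inner_add_left]
  rw [e1, e2, integral_add (integrable_mul_of_cont f₁ hd hdc) (integrable_mul_of_cont f₂ hd hdc),
    integral_add (integrable_inner_mul_of_cont G₁ e hφ.1.continuous hφ.2.1)
      (integrable_inner_mul_of_cont G₂ e hφ.1.continuous hφ.2.1), h₁ φ hφ e, h₂ φ hφ e]
  ring

theorem HasWeakGradient.smul {Ω : Set (Space d)} {f : L2 Ω} {G : L2Vec Ω} (a : ℝ)
    (h : HasWeakGradient Ω f G) : HasWeakGradient Ω (a • f) (a • G) := by
  intro φ hφ e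
  have e1 : ∫ x in Ω, (a • f : L2 Ω) x * fderiv ℝ φ x e
      = ∫ x in Ω, a * (f x * fderiv ℝ φ x e) := by
    refine integral_congr_ae ?_
    filter_upwards [Lp.coeFn_smul a f] with x hx
    simp only [hx, Pi.smul_apply, smul_eq_mul, mul_assoc]
  have e2 : ∫ x in Ω, inner ℝ ((a • G : L2Vec Ω) x) e * φ x
      = ∫ x in Ω, a * (inner ℝ (G x) e * φ x) := by
    refine integral_congr_ae ?_
    filter_upwards [Lp.coeFn_smul a G] with x hx
    simp only [hx, Pi.smul_apply, mul_assoc, real_inner_smul_left]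
  rw [e1, e2, integral_const_mul, integral_const_mul, h φ hφ e]
  ring

/-- The pairs `(f, ∇f)` with `f ∈ L²(Ω)` and weak gradient `∇f ∈ (L²(Ω))^d`, as a subspace of the
`ℓ²`-product `L²(Ω) × (L²(Ω))^d`. -/
def sobolevGraph (Ω : Set (Space d)) : Submodule ℝ (WithLp 2 (L2 Ω × L2Vec Ω)) where
  carrier := {w | HasWeakGradient Ω w.fst w.snd}
  zero_mem' := HasWeakGradient.zero Ω
  add_mem' := fun h₁ h₂ => HasWeakGradient.add h₁ h₂
  smul_mem' := fun a _ h => HasWeakGradient.smul a h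

/-- The Sobolev space `H¹(Ω)`. Its elements are stored together with their weak gradient (which is
unique on an open set), and the norm is the standard one, `‖f‖_{H¹}² = ‖f‖² + ‖∇f‖²`. -/
def H1 (Ω : Set (Space d)) : Type := sobolevGraph Ω

noncomputable instance (Ω : Set (Space d)) : NormedAddCommGroup (H1 Ω) :=
  inferInstanceAs (NormedAddCommGroup (sobolevGraph Ω))

noncomputable instance (Ω : Set (Space d)) : InnerProductSpace ℝ (H1 Ω) :=
  inferInstanceAs (InnerProductSpace ℝ (sobolevGraph Ω))

/-- The underlying `L²` function of an element of `H¹(Ω)`. -/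
def H1.val {Ω : Set (Space d)} (φ : H1 Ω) : L2 Ω := φ.1.fst

/-- The weak gradient of an element of `H¹(Ω)`. -/
def H1.grad {Ω : Set (Space d)} (φ : H1 Ω) : L2Vec Ω := φ.1.snd

theorem H1.norm_sq {Ω : Set (Space d)} (φ : H1 Ω) : ‖φ‖ ^ 2 = ‖φ.val‖ ^ 2 + ‖φ.grad‖ ^ 2 :=
  WithLp.prod_norm_sq_eq_of_L2 φ.1

/-- The dual space `(H¹(Ω))*`, with the operator norm. -/
abbrev H1Dual (Ω : Set (Space d)) : Type := StrongDual ℝ (H1 Ω)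

/-- For a field `v ∈ (L²(Ω))^d` with weak divergence `q ∈ L²(Ω)`: the normal trace `v · ν` vanishes
on `∂Ω`, in the usual sense of Green's formula, `∫_Ω v · ∇φ + ∫_Ω q φ = 0` for all
`φ ∈ H¹(Ω)`. -/
def HasZeroNormalTrace (Ω : Set (Space d)) (v : L2Vec Ω) (q : L2 Ω) : Prop :=
  ∀ φ : H1 Ω, (∫ x in Ω, inner ℝ (v x) (φ.grad x)) + ∫ x in Ω, q x * φ.val x = 0

/-- The space `H(Ω)` of `L²` fields with `∇ · v = 0` in `Ω` and `v · ν = 0` on `∂Ω`. -/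
def HSol (Ω : Set (Space d)) : Set (L2Vec Ω) :=
  {v | HasWeakDivergence Ω v 0 ∧ HasZeroNormalTrace Ω v 0}

/-- `c'` is the distributional time derivative on `(0,∞)` of `c`, as a function with values in
`(H¹(Ω))*`: `∫₀^∞ ψ'(t) (c(t), φ) dt = - ∫₀^∞ ψ(t) ⟨c'(t), φ⟩ dt` for all `ψ ∈ C_c^∞(0,∞)` and
`φ ∈ H¹(Ω)`. -/
def HasWeakTimeDeriv (Ω : Set (Space d)) (c : ℝ → L2 Ω) (c' : ℝ → H1Dual Ω) : Prop :=
  ∀ ψ : ℝ → ℝ, ContDiff ℝ (⊤ : ℕ∞) ψ → HasCompactSupport ψ → tsupport ψ ⊆ Ioi 0 → ∀ φ : H1 Ω,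
    ∫ t in Ioi (0 : ℝ), deriv ψ t * inner ℝ (c t) φ.val = -∫ t in Ioi (0 : ℝ), ψ t * c' t φ

/-- The time-integrability exponent of `∂c/∂t`. -/
noncomputable def timeExponent (d : ℕ) : ℝ≥0∞ := if d = 2 then 2 else 4 / 3

/-- The scalar parameters of the system: density contrast `α`, viscosity contrast `R`,
permeability `K`, diffusion coefficient `D`, adsorption coefficient `k`. -/
structure Params where
  α : ℝ
  R : ℝ
  K : ℝ
  D : ℝ
  k : ℝ
  α_pos : 0 < α
  R_pos : 0 < R
  K_pos : 0 < K
  D_pos : 0 < D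
  k_nonneg : 0 ≤ k

/-- The viscosity `μ(c) = exp(R c)`. -/
noncomputable def Params.viscosity (P : Params) (s : ℝ) : ℝ := Real.exp (P.R * s)

/-- The density `ρ(c) = 1 + α c`. -/
def Params.density (P : Params) (s : ℝ) : ℝ := 1 + P.α * s

/-- `(c, u)` is a weak solution of the system with initial datum `c₀`, where `cH t` is `c t`
regarded as an element of `H¹(Ω)` (so that it carries `∇c(t)`) and `c'` is `∂c/∂t`. -/
structure IsWeakSolutionWith (Ω : Set (Space d)) (P : Params) (g : Space d → Space d)
    (κ : Space d → ℝ) (c₀ : Space d → ℝ) (c : ℝ → L2 Ω) (u : ℝ → L2Vec Ω)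
    (cH : ℝ → H1 Ω) (c' : ℝ → H1Dual Ω) : Prop where
  /-- `c ∈ L^∞(0,∞; L^∞(Ω))` -/
  bounded : ∃ M : ℝ, ∀ᵐ t ∂(volume.restrict (Ioi (0 : ℝ))),
    eLpNorm (c t) ∞ (volume.restrict Ω) ≤ ENNReal.ofReal M
  /-- `c ∈ L²(0,∞; H¹(Ω))` -/
  val_eq : ∀ᵐ t ∂(volume.restrict (Ioi (0 : ℝ))), (cH t).val = c t
  memLp_H1 : MemLp cH 2 (volume.restrict (Ioi (0 : ℝ)))
  /-- `u ∈ L²(0,∞; H(Ω))` -/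
  memLp_u : MemLp u 2 (volume.restrict (Ioi (0 : ℝ)))
  u_mem : ∀ᵐ t ∂(volume.restrict (Ioi (0 : ℝ))), u t ∈ HSol Ω
  /-- `u ∈ L²(0,∞; L^p(Ω)^d)` for all `p ∈ [2,∞)` if `d = 2`, for all `p ∈ [2,6]` if `d = 3` -/
  u_Lp : ∀ p : ℝ≥0∞, 2 ≤ p → p ≠ ∞ → (d = 3 → p ≤ 6) →
    ∫⁻ t in Ioi (0 : ℝ), eLpNorm (u t) p (volume.restrict Ω) ^ 2 < ∞
  /-- `∂c/∂t ∈ L^r(0,T; (H¹(Ω))*)` for every finite `T` -/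
  timeDeriv : HasWeakTimeDeriv Ω c c'
  memLp_timeDeriv : ∀ T : ℝ, 0 < T → MemLp c' (timeExponent d) (volume.restrict (Ioo 0 T))
  /-- `c` denotes the representative that is (weakly) continuous into `(H¹(Ω))*`, so that
  `c(t)` is meaningful for every `t ≥ 0` -/
  continuous : ∀ φ : H1 Ω, ContinuousOn (fun t => inner ℝ (c t) φ.val) (Ici (0 : ℝ))
  /-- initial condition `c(0) = c₀` in `L²(Ω)` -/
  initial : c 0 =ᵐ[volume.restrict Ω] c₀
  /-- Darcy's law: `(μ(c)/K u, v) + (ρ(c) g, v) = 0` for all `v ∈ H(Ω)` -/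
  darcy : ∀ᵐ t ∂(volume.restrict (Ioi (0 : ℝ))), ∀ v ∈ HSol Ω,
    (∫ x in Ω, P.viscosity (c t x) / P.K * inner ℝ (u t x) (v x))
      + ∫ x in Ω, P.density (c t x) * inner ℝ (g x) (v x) = 0
  /-- transport: `(1+k) ⟨∂c/∂t, φ⟩ - (c u, ∇φ) + D (∇c, ∇φ) + (κ c, φ) = 0` for all
  `φ ∈ H¹(Ω)` -/
  transport : ∀ᵐ t ∂(volume.restrict (Ioi (0 : ℝ))), ∀ φ : H1 Ω,
    (1 + P.k) * c' t φ - (∫ x in Ω, c t x * inner ℝ (u t x) (φ.grad x))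
      + P.D * (∫ x in Ω, inner ℝ ((cH t).grad x) (φ.grad x))
      + ∫ x in Ω, κ x * c t x * φ.val x = 0

/-- `(c, u)` is a weak solution, on `(0,∞) × Ω`, of
`∇ · u = 0`, `μ(c)/K u = - ∇p - ρ(c) g`, `(1+k) ∂c/∂t + ∇ · (c u) = D Δc - κ c`,
with `u · ν = 0`, `∇c · ν = 0` on `∂Ω` and `c(0) = c₀`. -/
def IsWeakSolution (Ω : Set (Space d)) (P : Params) (g : Space d → Space d)
    (κ : Space d → ℝ) (c₀ : Space d → ℝ) (c : ℝ → L2 Ω) (u : ℝ → L2Vec Ω) : Prop :=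
  ∃ (cH : ℝ → H1 Ω) (c' : ℝ → H1Dual Ω), IsWeakSolutionWith Ω P g κ c₀ c u cH c'

end DensityFlow

/-!
The weighted concentration `w(t) = e^{λt} c(t)`, with `λ = κ₁ / (1 + k)`, does not increase any convex
functional `∫_Ω j(w)`. Formally, testing the transport equation with `β(w)`, `β = j'`, gives

`(1 + k) d/dt ∫ j(w) = ∫ u · ∇B(w) - D ∫ β'(w) |∇w|² - ∫ (κ - κ₁) w β(w) ≤ 0`, `B'(s) = s β'(s)`:

the first term vanishes because `u` is solenoidal with zero normal trace, the other two have a sign.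
With `j(s) = (s² + ε)^{p/2} - ε^{p/2}` and `ε → 0` this gives `‖w(t)‖_p ≤ ‖c₀‖_p` for finite `p ≥ 1`,
and `p = ∞` follows in the limit, so that the decay estimate holds with `C_p = 1`.

Two points need proof beyond the formal computation.

* `β(w)` and `B(w)` have to be elements of `H¹(Ω)`. For bounded functions the product rule
  `WeakGrad.mul` follows by mollification inside `Ω`; it gives the chain rule for polynomials, and
  Weierstrass approximation extends it to `C¹` functions (`WeakGrad.comp`, `H1.exists_comp`). The
  dissipation inequality at a fixed time is `timeDeriv_comp_le`.
* `∂_t w` is only an element of `(H¹(Ω))*`. The transport equation puts it in `L²(0,T; (H¹(Ω))*)`, and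
  convexity gives the one-sided difference inequality
  `∫ j(w(t)) - ∫ j(w(t - h)) ≤ ∫_{t-h}^t ⟨∂_t w(τ), β(w(t))⟩ dτ`. Replacing `∂_t w(τ)` by `∂_t w(t)`
  makes the right-hand side nonpositive, at the price of an error that is `o(h)` after integration
  over `t`, by continuity of translations in `L²` (`exists_le_of_increment_le`). This bounds
  `∫ j(w)` at times arbitrarily close to any given `T`; weak continuity of `w` and lower
  semicontinuity of the functional (`integral_comp_le_of_weak_limit`) give the bound at `T` itself.
  Of the test functions `β(w(t))` only the size of their `H¹(Ω)` norm enters, not their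
  measurability in `t`.
-/

namespace DensityFlow

open Filter Topology

variable {d : ℕ}

/-! ### Mollification and the product rule for weak gradients -/

section Mollifier

variable (E : Type*) [NormedAddCommGroup E]

/-- The smooth bump function of radius `1 / (n + 1)` around the origin. -/
noncomputable def bump (n : ℕ) : ContDiffBump (0 : E) where
  rIn := 1 / (2 * ((n : ℝ) + 1))
  rOut := 1 / ((n : ℝ) + 1)
  rIn_pos := by positivity
  rIn_lt_rOut := by
    apply one_div_lt_one_div_of_lt <;> linarith [(Nat.cast_nonneg n : (0 : ℝ) ≤ n)]

theorem tendsto_bump_rOut : Tendsto (fun n => (bump E n).rOut) atTop (𝓝 0) :=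
  tendsto_one_div_add_atTop_nhds_zero_nat

variable [NormedSpace ℝ E] [FiniteDimensional ℝ E] [MeasureSpace E]

/-- The standard mollifier: the bump function of radius `1 / (n + 1)`, normalised to integral 1. -/
noncomputable def mollifier (n : ℕ) : E → ℝ := (bump E n).normed volume

theorem contDiff_mollifier (n : ℕ) : ContDiff ℝ (⊤ : ℕ∞) (mollifier E n) :=
  (bump E n).contDiff_normed

theorem mollifier_nonneg (n : ℕ) (x : E) : 0 ≤ mollifier E n x :=
  (bump E n).nonneg_normed x

theorem mollifier_sub_comm (n : ℕ) (x y : E) :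
    mollifier E n (x - y) = mollifier E n (y - x) := by
  rw [← neg_sub y x]
  exact (bump E n).normed_neg _

variable [BorelSpace E] [(volume : Measure E).IsAddHaarMeasure]

theorem hasCompactSupport_mollifier (n : ℕ) : HasCompactSupport (mollifier E n) :=
  (bump E n).hasCompactSupport_normed

theorem integral_mollifier (n : ℕ) : ∫ x, mollifier E n x = 1 :=
  (bump E n).integral_normed

theorem tsupport_mollifier (n : ℕ) :
    tsupport (mollifier E n) = Metric.closedBall 0 (1 / ((n : ℝ) + 1)) :=
  (bump E n).tsupport_normed_eq

theorem support_mollifier (n : ℕ) :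
    Function.support (mollifier E n) = Metric.ball 0 (1 / ((n : ℝ) + 1)) :=
  (bump E n).support_normed_eq

end Mollifier

/-- Mollification converges weakly: `∫ a (ρ_n ⋆ b) → ∫ a b` for integrable `a` and bounded `b`. The
mollified functions converge almost everywhere by Lebesgue differentiation and keep the bound of
`b`, so no strong convergence in `L^p` is needed. -/
theorem tendsto_integral_mollifier {Ω : Set (Space d)} (hm : MeasurableSet Ω)
    (hfin : volume Ω ≠ ∞) {a b : Space d → ℝ} (ha : Integrable a (volume.restrict Ω))
    (hbm : AEStronglyMeasurable b (volume.restrict Ω)) {M : ℝ} (hM : 0 ≤ M)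
    (hb : ∀ᵐ x ∂(volume.restrict Ω), |b x| ≤ M) :
    Tendsto (fun n => ∫ x in Ω, a x * ∫ y in Ω, mollifier (Space d) n (x - y) * b y) atTop
      (𝓝 (∫ x in Ω, a x * b x)) := by
  have : IsFiniteMeasure (volume.restrict Ω) := ⟨by simpa using hfin.lt_top⟩
  have hbi : Integrable b (volume.restrict Ω) :=
    Integrable.of_bound hbm M (by simpa using hb)
  have hbi' : Integrable (Ω.indicator b) := (integrable_indicator_iff hm).2 hbi
  have hlim := ContDiffBump.ae_convolution_tendsto_right_of_locallyIntegrable (K := 2)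
    (tendsto_bump_rOut (Space d)) (Eventually.of_forall fun n => by
      simp only [bump]; apply le_of_eq; field_simp) hbi'.locallyIntegrable
  have hconv : ∀ n x, ∫ y in Ω, mollifier (Space d) n (x - y) * b y =
      (convolution ((bump (Space d) n).normed volume) (Ω.indicator b) (ContinuousLinearMap.lsmul ℝ ℝ)
        volume) x := by
    intro n x
    rw [convolution_lsmul_swap, ← integral_indicator hm]
    congr 1; ext y
    by_cases hy : y ∈ Ω <;> simp [hy, mollifier]
  have hbd : ∀ n x, |∫ y in Ω, mollifier (Space d) n (x - y) * b y| ≤ M := by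
    intro n x
    have hint : Integrable (fun y => mollifier (Space d) n (x - y)) :=
      ((contDiff_mollifier (Space d) n).continuous.integrable_of_hasCompactSupport
        (hasCompactSupport_mollifier (Space d) n)).comp_sub_left x
    calc |∫ y in Ω, mollifier (Space d) n (x - y) * b y|
        ≤ ∫ y in Ω, mollifier (Space d) n (x - y) * M := by
          rw [← Real.norm_eq_abs]
          refine norm_integral_le_of_norm_le (hint.restrict.mul_const M) ?_
          filter_upwards [hb] with y hy
          rw [norm_mul, Real.norm_eq_abs, Real.norm_eq_abs, abs_of_nonneg (mollifier_nonneg _ _ _)]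
          exact mul_le_mul_of_nonneg_left hy (mollifier_nonneg _ _ _)
      _ ≤ ∫ y, mollifier (Space d) n (x - y) * M :=
          setIntegral_le_integral (hint.mul_const M)
            (Eventually.of_forall fun y => mul_nonneg (mollifier_nonneg _ _ _) hM)
      _ = M := by
          rw [integral_mul_const, integral_sub_left_eq_self (mollifier (Space d) n) volume x,
            integral_mollifier, one_mul]
  refine tendsto_integral_of_dominated_convergence (fun x => |a x| * M) ?_
    (ha.abs.mul_const M) ?_ ?_
  · intro n
    refine ha.aestronglyMeasurable.mul ?_
    simp_rw [hconv]
    exact ((hasCompactSupport_mollifier (Space d) n).continuous_convolution_left _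
      (contDiff_mollifier (Space d) n).continuous hbi'.locallyIntegrable).aestronglyMeasurable
  · intro n
    refine Eventually.of_forall fun x => ?_
    rw [norm_mul, Real.norm_eq_abs, Real.norm_eq_abs]
    exact mul_le_mul_of_nonneg_left (hbd n x) (abs_nonneg _)
  · filter_upwards [ae_restrict_of_ae hlim, ae_restrict_mem hm] with x hx hxm
    simp_rw [hconv]
    simpa [hxm] using hx.const_mul (a x)

/-- A smooth kernel is integrable against a product of two integrable functions. -/
theorem integrable_prod_kernel {Ω : Set (Space d)} {a b : Space d → ℝ}
    (ha : Integrable a (volume.restrict Ω)) (hb : Integrable b (volume.restrict Ω))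
    {k : Space d → ℝ} (hk : Continuous k) (hkc : HasCompactSupport k) :
    Integrable (fun z : Space d × Space d => a z.1 * (k (z.1 - z.2) * b z.2))
      ((volume.restrict Ω).prod (volume.restrict Ω)) := by
  obtain ⟨C, hC⟩ := hk.bounded_above_of_compact_support hkc
  have h := (ha.mul_prod hb).bdd_mul (f := fun z : Space d × Space d => k (z.1 - z.2)) (c := C)
    (by fun_prop : Continuous fun z : Space d × Space d => k (z.1 - z.2)).aestronglyMeasurable
    (Eventually.of_forall fun z => hC _)
  refine h.congr (Eventually.of_forall fun z => ?_)
  simp only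
  ring

theorem integral_kernel_swap {Ω : Set (Space d)} {a b : Space d → ℝ}
    (ha : Integrable a (volume.restrict Ω)) (hb : Integrable b (volume.restrict Ω))
    {k : Space d → ℝ} (hk : Continuous k) (hkc : HasCompactSupport k) :
    ∫ x in Ω, a x * ∫ y in Ω, k (x - y) * b y = ∫ y in Ω, b y * ∫ x in Ω, k (x - y) * a x := by
  simp_rw [← integral_const_mul]
  rw [integral_integral_swap (integrable_prod_kernel ha hb hk hkc)]
  congr 1; ext y; congr 1; ext x; ring

theorem integrable_integral_kernel {Ω : Set (Space d)} {a b : Space d → ℝ}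
    (ha : Integrable a (volume.restrict Ω)) (hb : Integrable b (volume.restrict Ω))
    {k : Space d → ℝ} (hk : Continuous k) (hkc : HasCompactSupport k) :
    Integrable (fun y => b y * ∫ x in Ω, k (x - y) * a x) (volume.restrict Ω) := by
  refine (integrable_prod_kernel ha hb hk hkc).integral_prod_right.congr
    (Eventually.of_forall fun y => ?_)
  simp only [← integral_const_mul]
  congr 1; ext x; ring

/-- The weak gradient for functions, with no integrability built in:
`∫_Ω f ∂_e φ = - ∫_Ω (G · e) φ` for all `φ ∈ C_c^∞(Ω)`. -/
def WeakGrad (Ω : Set (Space d)) (f : Space d → ℝ) (G : Space d → Space d) : Prop :=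
  ∀ φ : Space d → ℝ, IsTestFunction Ω φ → ∀ e : Space d,
    ∫ x in Ω, f x * fderiv ℝ φ x e = -∫ x in Ω, inner ℝ (G x) e * φ x

theorem IsTestFunction.mul_left {Ω : Set (Space d)} {φ : Space d → ℝ} (h : IsTestFunction Ω φ)
    {ψ : Space d → ℝ} (hψ : ContDiff ℝ (⊤ : ℕ∞) ψ) : IsTestFunction Ω (fun x => ψ x * φ x) :=
  ⟨hψ.mul h.1, h.2.1.mul_left, (tsupport_mul_subset_right).trans h.2.2⟩

/-- The product rule for bounded functions with square-integrable weak gradient. Both factors are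
evaluated at different points, coupled by a mollifier `ρ(x - y)`: since `(∂_x + ∂_y) ρ(x - y) = 0`,
the derivatives of the mollifier cancel, and the remaining double integrals converge. -/
theorem WeakGrad.mul {Ω : Set (Space d)} (ho : IsOpen Ω) (hfin : volume Ω ≠ ∞)
    {f g : Space d → ℝ} {F G : Space d → Space d}
    (hfm : AEStronglyMeasurable f (volume.restrict Ω))
    (hgm : AEStronglyMeasurable g (volume.restrict Ω)) {M : ℝ}
    (hf : ∀ᵐ x ∂(volume.restrict Ω), |f x| ≤ M) (hg : ∀ᵐ x ∂(volume.restrict Ω), |g x| ≤ M)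
    (hF : Integrable F (volume.restrict Ω)) (hG : Integrable G (volume.restrict Ω))
    (h₁ : WeakGrad Ω f F) (h₂ : WeakGrad Ω g G) :
    WeakGrad Ω (fun x => f x * g x) (fun x => f x • G x + g x • F x) := by
  wlog hM : 0 ≤ M generalizing M
  · exact this (M := |M|) (hf.mono fun x h => h.trans (le_abs_self M))
      (hg.mono fun x h => h.trans (le_abs_self M)) (abs_nonneg M)
  intro φ hφ e
  have : IsFiniteMeasure (volume.restrict Ω) := ⟨by simpa using hfin.lt_top⟩
  have hm := ho.measurableSet
  have hfi : Integrable f (volume.restrict Ω) := Integrable.of_bound hfm M (by simpa using hf)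
  have hgi : Integrable g (volume.restrict Ω) := Integrable.of_bound hgm M (by simpa using hg)
  have hFe : Integrable (fun x => inner ℝ (F x) e) (volume.restrict Ω) := hF.inner_const e
  have hGe : Integrable (fun x => inner ℝ (G x) e) (volume.restrict Ω) := hG.inner_const e
  have hφc := hφ.1.continuous
  have hdc := hφ.continuous_fderiv_apply e
  obtain ⟨Cφ, hCφ⟩ := hφc.bounded_above_of_compact_support hφ.2.1
  obtain ⟨Cd, hCd⟩ := hdc.bounded_above_of_compact_support (hφ.2.1.fderiv_apply ℝ e)
  have hCφ0 : 0 ≤ Cφ := (norm_nonneg _).trans (hCφ 0)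
  have hfφ : Integrable (fun x => f x * φ x) (volume.restrict Ω) :=
    hfi.mul_bdd hφc.aestronglyMeasurable (Eventually.of_forall hCφ)
  have hfd : Integrable (fun x => f x * fderiv ℝ φ x e) (volume.restrict Ω) :=
    hfi.mul_bdd hdc.aestronglyMeasurable (Eventually.of_forall hCd)
  have hFφ : Integrable (fun x => inner ℝ (F x) e * φ x) (volume.restrict Ω) :=
    hFe.mul_bdd hφc.aestronglyMeasurable (Eventually.of_forall hCφ)
  have hfφb : ∀ᵐ x ∂(volume.restrict Ω), |f x * φ x| ≤ M * Cφ := by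
    filter_upwards [hf] with x hx
    rw [abs_mul]
    exact mul_le_mul hx (hCφ x) (abs_nonneg _) hM
  -- the three double integrals and their limits
  have L1 := tendsto_integral_mollifier hm hfin hfd hgm hM hg
  have L2 := tendsto_integral_mollifier hm hfin hFφ hgm hM hg
  have L3 := tendsto_integral_mollifier hm hfin hGe hfφ.aestronglyMeasurable
    (mul_nonneg hM hCφ0) hfφb
  obtain ⟨δ, hδ, hδΩ⟩ := hφ.2.1.isCompact.exists_cthickening_subset_open ho hφ.2.2
  have hev : ∀ᶠ n : ℕ in atTop, 1 / ((n : ℝ) + 1) < δ :=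
    tendsto_one_div_add_atTop_nhds_zero_nat.eventually_lt_const hδ
  have key : ∀ᶠ n : ℕ in atTop,
      (∫ x in Ω, f x * fderiv ℝ φ x e * ∫ y in Ω, mollifier (Space d) n (x - y) * g y)
      = -(∫ x in Ω, inner ℝ (F x) e * φ x * ∫ y in Ω, mollifier (Space d) n (x - y) * g y)
        - ∫ x in Ω, inner ℝ (G x) e * ∫ y in Ω, mollifier (Space d) n (x - y) * (f y * φ y) := by
    filter_upwards [hev] with n hn
    set ρ := mollifier (Space d) n with hρ
    have hρs := contDiff_mollifier (Space d) n
    have hρk := hasCompactSupport_mollifier (Space d) n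
    have hρd : Continuous fun x => fderiv ℝ ρ x e :=
      (hρs.continuous_fderiv (by simp)).clm_apply continuous_const
    have hρdk : HasCompactSupport fun x => fderiv ℝ ρ x e := hρk.fderiv_apply ℝ e
    -- the weak gradient of `f`, tested with `ρ(· - y) φ`
    have e1 : ∀ y, (∫ x in Ω, ρ (x - y) * (f x * fderiv ℝ φ x e))
        + (∫ x in Ω, fderiv ℝ ρ (x - y) e * (f x * φ x))
        = -∫ x in Ω, ρ (x - y) * (inner ℝ (F x) e * φ x) := by
      intro y
      have hsm : ContDiff ℝ (⊤ : ℕ∞) fun x => ρ (x - y) := hρs.comp (contDiff_id.sub contDiff_const)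
      have ht := h₁ _ (hφ.mul_left hsm) e
      obtain ⟨C1, hC1⟩ := hρs.continuous.bounded_above_of_compact_support hρk
      obtain ⟨C2, hC2⟩ := hρd.bounded_above_of_compact_support hρdk
      rw [← integral_add]
      · have e3 : ∀ x, fderiv ℝ (fun x => ρ (x - y) * φ x) x e
            = ρ (x - y) * fderiv ℝ φ x e + fderiv ℝ ρ (x - y) e * φ x := by
          intro x
          have hd1 : DifferentiableAt ℝ (fun x => ρ (x - y)) x :=
            hsm.differentiable (by simp) x
          rw [fderiv_fun_mul hd1 (hφ.1.differentiable (by simp) x)]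
          have hd2 : fderiv ℝ (fun x => ρ (x - y)) x = fderiv ℝ ρ (x - y) := by
            exact fderiv_comp_sub y
          simp [hd2, mul_comm]
        simp_rw [e3] at ht
        convert ht using 2
        · ext x; ring
        · congr 1; ext x; ring
      · exact hfd.bdd_mul (c := C1) (hρs.continuous.comp
          (continuous_id.sub continuous_const)).aestronglyMeasurable
          (Eventually.of_forall fun x => hC1 _)
      · exact hfφ.bdd_mul (c := C2) (hρd.comp
          (continuous_id.sub continuous_const)).aestronglyMeasurable
          (Eventually.of_forall fun x => hC2 _)
    -- the weak gradient of `g`, tested with `ρ(x - ·)`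
    have e2 : ∀ x, f x * φ x * (∫ y in Ω, fderiv ℝ ρ (x - y) e * g y)
        = f x * φ x * ∫ y in Ω, ρ (x - y) * inner ℝ (G y) e := by
      intro x
      by_cases hx : x ∈ tsupport φ
      swap
      · simp [image_eq_zero_of_notMem_tsupport hx]
      congr 1
      have hsm : ContDiff ℝ (⊤ : ℕ∞) fun y => ρ (x - y) := hρs.comp (contDiff_const.sub contDiff_id)
      have htest : IsTestFunction Ω fun y => ρ (x - y) := by
        have hs : tsupport (fun y => ρ (x - y)) ⊆ Metric.closedBall x (1 / ((n : ℝ) + 1)) := by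
          refine closure_minimal ?_ Metric.isClosed_closedBall
          intro y hy
          have : x - y ∈ tsupport ρ := subset_tsupport _ hy
          rw [hρ, tsupport_mollifier] at this
          simpa [dist_eq_norm, norm_sub_rev] using this
        refine ⟨hsm, ?_, hs.trans (Subset.trans ?_ hδΩ)⟩
        · exact IsCompact.of_isClosed_subset (isCompact_closedBall _ _) (isClosed_tsupport _) hs
        · exact (Metric.closedBall_subset_closedBall hn.le).trans
            (Metric.closedBall_subset_cthickening hx δ)
      have ht := h₂ _ htest e
      have e3 : ∀ y, fderiv ℝ (fun y => ρ (x - y)) y e = -fderiv ℝ ρ (x - y) e := by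
        intro y
        have hd2 : HasFDerivAt (fun y => ρ (x - y)) _ y :=
          (hρs.differentiable (by simp) (x - y)).hasFDerivAt.comp y
            ((hasFDerivAt_const x y).sub (hasFDerivAt_id y))
        rw [hd2.fderiv]
        simp [hρ]
      simp_rw [e3, mul_neg, integral_neg, neg_inj] at ht
      convert ht using 2
      · ext y; ring
      · ext y; ring
    rw [integral_kernel_swap hfd hgi hρs.continuous hρk,
      integral_kernel_swap hFφ hgi hρs.continuous hρk]
    have e4 : ∫ x in Ω, inner ℝ (G x) e * ∫ y in Ω, ρ (x - y) * (f y * φ y)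
        = ∫ y in Ω, g y * ∫ x in Ω, fderiv ℝ ρ (x - y) e * (f x * φ x) := by
      rw [← integral_kernel_swap hfφ hgi hρd hρdk, integral_congr_ae (Eventually.of_forall e2),
        integral_kernel_swap hfφ hGe hρs.continuous hρk]
      simp only [hρ, mollifier_sub_comm (Space d) n _ _]
    rw [e4, ← integral_neg, ← integral_sub]
    · congr 1; ext y
      have := e1 y
      linear_combination (g y) * this
    · exact (integrable_integral_kernel hFφ hgi hρs.continuous hρk).neg
    · exact integrable_integral_kernel hfφ hgi hρd hρdk
  have hlim := tendsto_nhds_unique (L1.congr' key) (L2.neg.sub L3)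
  have i1 : Integrable (fun x => inner ℝ (F x) e * φ x * g x) (volume.restrict Ω) :=
    hFφ.mul_bdd hgm hg
  have i2 : Integrable (fun x => inner ℝ (G x) e * (f x * φ x)) (volume.restrict Ω) :=
    hGe.mul_bdd hfφ.aestronglyMeasurable hfφb
  rw [← integral_neg, ← integral_sub (by exact i1.neg) i2] at hlim
  rw [← integral_neg]
  convert hlim using 2
  · ext x; ring
  · ext x
    simp only [inner_add_left, real_inner_smul_left]
    ring

/-! ### The chain rule for weak gradients -/

theorem WeakGrad.congr {Ω : Set (Space d)} {f f' : Space d → ℝ} {G G' : Space d → Space d}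
    (h : WeakGrad Ω f G) (hf : f' =ᵐ[volume.restrict Ω] f) (hG : G' =ᵐ[volume.restrict Ω] G) :
    WeakGrad Ω f' G' := by
  intro φ hφ e
  have e1 : ∫ x in Ω, f' x * fderiv ℝ φ x e = ∫ x in Ω, f x * fderiv ℝ φ x e :=
    integral_congr_ae (hf.mono fun x hx => by simp only [hx])
  have e2 : ∫ x in Ω, inner ℝ (G' x) e * φ x = ∫ x in Ω, inner ℝ (G x) e * φ x :=
    integral_congr_ae (hG.mono fun x hx => by simp only [hx])
  rw [e1, e2, h φ hφ e]

theorem WeakGrad.const (Ω : Set (Space d)) (a : ℝ) : WeakGrad Ω (fun _ => a) (fun _ => 0) := by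
  intro φ hφ e
  have hs : Function.support (fun x => a * fderiv ℝ φ x e) ⊆ Ω := by
    intro x hx
    refine hφ.2.2 (support_fderiv_subset ℝ (f := φ) fun h => hx ?_)
    simp [h]
  rw [setIntegral_eq_integral_of_forall_compl_eq_zero
    (fun x hx => Function.notMem_support.1 fun h => hx (hs h)), integral_const_mul]
  have i1 : Integrable (fun x => fderiv ℝ φ x e) volume :=
    (hφ.continuous_fderiv_apply e).integrable_of_hasCompactSupport (hφ.2.1.fderiv_apply ℝ e)
  have i2 : Integrable φ volume := hφ.1.continuous.integrable_of_hasCompactSupport hφ.2.1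
  have h0 : ∫ x, fderiv ℝ φ x e = 0 := by
    have := integral_mul_fderiv_eq_neg_fderiv_mul_of_integrable (μ := volume)
      (f := fun _ => (1 : ℝ)) (g := φ) (v := e) (by simp) (by simpa using i1) (by simpa using i2)
      (fun _ _ => by fun_prop) (fun x _ => hφ.1.differentiable (by simp) x)
    simpa using this
  rw [h0]
  simp

theorem WeakGrad.add {Ω : Set (Space d)} {f g : Space d → ℝ} {F G : Space d → Space d}
    (hf : Integrable f (volume.restrict Ω)) (hg : Integrable g (volume.restrict Ω))
    (hF : Integrable F (volume.restrict Ω)) (hG : Integrable G (volume.restrict Ω))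
    (h₁ : WeakGrad Ω f F) (h₂ : WeakGrad Ω g G) :
    WeakGrad Ω (fun x => f x + g x) (fun x => F x + G x) := by
  intro φ hφ e
  obtain ⟨C, hC⟩ := hφ.1.continuous.bounded_above_of_compact_support hφ.2.1
  obtain ⟨D, hD⟩ := (hφ.continuous_fderiv_apply e).bounded_above_of_compact_support
    (hφ.2.1.fderiv_apply ℝ e)
  have i1 : ∀ {a : Space d → ℝ}, Integrable a (volume.restrict Ω) →
      Integrable (fun x => a x * φ x) (volume.restrict Ω) := fun h =>
    h.mul_bdd hφ.1.continuous.aestronglyMeasurable (Eventually.of_forall hC)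
  have i2 : ∀ {a : Space d → ℝ}, Integrable a (volume.restrict Ω) →
      Integrable (fun x => a x * fderiv ℝ φ x e) (volume.restrict Ω) := fun h =>
    h.mul_bdd (hφ.continuous_fderiv_apply e).aestronglyMeasurable (Eventually.of_forall hD)
  simp only [inner_add_left, add_mul]
  rw [integral_add (i2 hf) (i2 hg), integral_add (i1 (hF.inner_const e)) (i1 (hG.inner_const e)),
    h₁ φ hφ e, h₂ φ hφ e]
  ring

/-- A continuous function of a function with values in `[-A, A]` is bounded. -/
theorem exists_bound_comp {Ω : Set (Space d)} {f : Space d → ℝ} {A : ℝ}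
    (hf : ∀ᵐ x ∂(volume.restrict Ω), |f x| ≤ A) {β : ℝ → ℝ} (hβ : Continuous β) :
    ∃ B, 0 ≤ B ∧ (∀ s, |s| ≤ A → |β s| ≤ B) ∧ ∀ᵐ x ∂(volume.restrict Ω), |β (f x)| ≤ B := by
  obtain ⟨B, hB⟩ := (isCompact_Icc (a := -A) (b := A)).exists_bound_of_continuousOn hβ.continuousOn
  have h : ∀ s, |s| ≤ A → |β s| ≤ max B 0 := fun s hs =>
    (hB s (abs_le.1 hs)).trans (le_max_left _ _)
  exact ⟨max B 0, le_max_right _ _, h, hf.mono fun x hx => h _ hx⟩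

theorem WeakGrad.polynomial {Ω : Set (Space d)} (ho : IsOpen Ω) (hfin : volume Ω ≠ ∞)
    {f : Space d → ℝ} {F : Space d → Space d}
    (hfm : AEStronglyMeasurable f (volume.restrict Ω)) {A : ℝ}
    (hf : ∀ᵐ x ∂(volume.restrict Ω), |f x| ≤ A)
    (hF : Integrable F (volume.restrict Ω)) (h : WeakGrad Ω f F) (p : Polynomial ℝ) :
    WeakGrad Ω (fun x => p.eval (f x)) (fun x => p.derivative.eval (f x) • F x) := by
  have : IsFiniteMeasure (volume.restrict Ω) := ⟨by simpa using hfin.lt_top⟩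
  have hev : ∀ q : Polynomial ℝ, ∃ B, 0 ≤ B ∧ (∀ s, |s| ≤ A → |q.eval s| ≤ B) ∧
    ∀ᵐ x ∂(volume.restrict Ω), |q.eval (f x)| ≤ B := fun q => exists_bound_comp hf q.continuous
  have hmeas : ∀ q : Polynomial ℝ, AEStronglyMeasurable (fun x => q.eval (f x))
    (volume.restrict Ω) := fun q => q.continuous.comp_aestronglyMeasurable hfm
  have hint : ∀ q : Polynomial ℝ, Integrable (fun x => q.eval (f x)) (volume.restrict Ω) := by
    intro q
    obtain ⟨B, -, -, hB⟩ := hev q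
    exact Integrable.of_bound (hmeas q) B hB
  have hint' : ∀ q : Polynomial ℝ, Integrable (fun x => q.eval (f x) • F x)
      (volume.restrict Ω) := by
    intro q
    obtain ⟨B, -, -, hB⟩ := hev q
    exact hF.bdd_smul B (hmeas q) hB
  induction p using Polynomial.induction_on with
  | C a => simpa using WeakGrad.const Ω a
  | add p q hp hq =>
    simpa [add_smul] using WeakGrad.add (hint p) (hint q) (hint' _) (hint' _) hp hq
  | monomial n a ih =>
    set q : Polynomial ℝ := Polynomial.C a * Polynomial.X ^ n with hq
    have e : Polynomial.C a * Polynomial.X ^ (n + 1) = q * Polynomial.X := by rw [hq]; ring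
    rw [e]
    obtain ⟨B, -, -, hB⟩ := hev q
    have := WeakGrad.mul ho hfin (hmeas q) hfm (M := max A B)
      (hB.mono fun x hx => hx.trans (le_max_right _ _))
      (hf.mono fun x hx => hx.trans (le_max_left _ _)) (hint' _) hF ih h
    refine (this.congr (Eventually.of_forall fun x => ?_) (Eventually.of_forall fun x => ?_))
    · simp
    · simp [smul_smul, add_smul, mul_comm]

theorem exists_polynomial_derivative_eq (q : Polynomial ℝ) :
    ∃ p : Polynomial ℝ, p.derivative = q := by
  induction q using Polynomial.induction_on with
  | C a => exact ⟨Polynomial.C a * Polynomial.X, by simp⟩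
  | add p q hp hq =>
    obtain ⟨p', rfl⟩ := hp
    obtain ⟨q', rfl⟩ := hq
    exact ⟨p' + q', by simp⟩
  | monomial n a _ =>
    refine ⟨Polynomial.C (a / (n + 2)) * Polynomial.X ^ (n + 2), ?_⟩
    rw [Polynomial.derivative_C_mul_X_pow]
    have : ((n : ℝ) + 2) ≠ 0 := by positivity
    congr 2
    push_cast
    field_simp

/-- Weierstrass approximation in `C¹([-A, A])`. -/
theorem exists_polynomial_near_C1 {β β' : ℝ → ℝ} (hβ : ∀ s, HasDerivAt β (β' s) s)
    (hβ' : Continuous β') {A : ℝ} {ε : ℝ} (hε : 0 < ε) :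
    ∃ p : Polynomial ℝ, ∀ s, |s| ≤ A →
      |p.derivative.eval s - β' s| ≤ ε ∧ |p.eval s - β s| ≤ ε * A := by
  obtain ⟨q, hq⟩ := exists_polynomial_near_of_continuousOn (-A) A β' hβ'.continuousOn ε hε
  obtain ⟨p, hp⟩ := exists_polynomial_derivative_eq q
  refine ⟨p + Polynomial.C (β 0 - p.eval 0), fun s hs => ?_⟩
  have hA : 0 ≤ A := (abs_nonneg s).trans hs
  have h1 : ∀ r ∈ Icc (-A) A, ‖q.eval r - β' r‖ ≤ ε := fun r hr => (hq r hr).le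
  refine ⟨by simpa [hp] using h1 s (abs_le.1 hs), ?_⟩
  have hd : ∀ r ∈ Icc (-A) A, HasDerivWithinAt (fun r => p.eval r - β r) (q.eval r - β' r)
      (Icc (-A) A) r := fun r _ => by
    rw [← hp]
    exact ((p.hasDerivAt r).sub (hβ r)).hasDerivWithinAt
  have := (convex_Icc (-A) A).norm_image_sub_le_of_norm_hasDerivWithin_le hd h1
    (x := 0) (y := s) ⟨by linarith, hA⟩ (abs_le.1 hs)
  calc _ = ‖(p.eval s - β s) - (p.eval 0 - β 0)‖ := by
        rw [Real.norm_eq_abs]; congr 1; simp; ring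
    _ ≤ ε * ‖s - 0‖ := this
    _ ≤ ε * A := by
      rw [sub_zero]
      exact mul_le_mul_of_nonneg_left hs hε.le

/-- The chain rule for a bounded function with integrable weak gradient and a `C¹` function `β`,
obtained from the polynomial case by approximating `β` in `C¹`. -/
theorem WeakGrad.comp {Ω : Set (Space d)} (ho : IsOpen Ω) (hfin : volume Ω ≠ ∞)
    {f : Space d → ℝ} {F : Space d → Space d}
    (hfm : AEStronglyMeasurable f (volume.restrict Ω)) {A : ℝ}
    (hf : ∀ᵐ x ∂(volume.restrict Ω), |f x| ≤ A)
    (hF : Integrable F (volume.restrict Ω)) (h : WeakGrad Ω f F)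
    {β β' : ℝ → ℝ} (hβ : ∀ s, HasDerivAt β (β' s) s) (hβ' : Continuous β') :
    WeakGrad Ω (fun x => β (f x)) (fun x => β' (f x) • F x) := by
  have : IsFiniteMeasure (volume.restrict Ω) := ⟨by simpa using hfin.lt_top⟩
  intro φ hφ e
  have hβc : Continuous β := continuous_iff_continuousAt.2 fun s => (hβ s).continuousAt
  choose p hp using fun n : ℕ => exists_polynomial_near_C1 hβ hβ' (A := A)
    (Nat.one_div_pos_of_nat (α := ℝ) (n := n))
  have hn1 : ∀ n : ℕ, 1 / ((n : ℝ) + 1) ≤ 1 := fun n => by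
    rw [div_le_one (by positivity)]; linarith [(Nat.cast_nonneg n : (0 : ℝ) ≤ n)]
  obtain ⟨C, hC⟩ := hφ.1.continuous.bounded_above_of_compact_support hφ.2.1
  have hdi : Integrable (fun x => fderiv ℝ φ x e) (volume.restrict Ω) :=
    ((hφ.continuous_fderiv_apply e).integrable_of_hasCompactSupport
      (hφ.2.1.fderiv_apply ℝ e)).restrict
  have hFφ : Integrable (fun x => inner ℝ (F x) e * φ x) (volume.restrict Ω) :=
    (hF.inner_const e).mul_bdd hφ.1.continuous.aestronglyMeasurable (Eventually.of_forall hC)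
  have hz : ∀ c : ℝ, Tendsto (fun n : ℕ => 1 / ((n : ℝ) + 1) * c) atTop (𝓝 0) := fun c => by
    simpa using (tendsto_one_div_add_atTop_nhds_zero_nat (𝕜 := ℝ)).mul_const c
  obtain ⟨B, hB0, -, hB⟩ := exists_bound_comp hf hβc
  obtain ⟨B', hB'0, -, hB'⟩ := exists_bound_comp hf hβ'
  have L1 : Tendsto (fun n => ∫ x in Ω, (p n).eval (f x) * fderiv ℝ φ x e) atTop
      (𝓝 (∫ x in Ω, β (f x) * fderiv ℝ φ x e)) := by
    refine tendsto_integral_of_dominated_convergence (fun x => (B + |A|) * |fderiv ℝ φ x e|)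
      (fun n => ((p n).continuous.comp_aestronglyMeasurable hfm).mul hdi.aestronglyMeasurable)
      (hdi.abs.const_mul _) (fun n => ?_) ?_
    · filter_upwards [hf, hB] with x hx hbx
      rw [norm_mul, Real.norm_eq_abs, Real.norm_eq_abs]
      refine mul_le_mul_of_nonneg_right ?_ (abs_nonneg _)
      have h1 := (hp n (f x) hx).2
      have h2 : 1 / ((n : ℝ) + 1) * A ≤ |A| := by
        calc _ ≤ 1 / ((n : ℝ) + 1) * |A| :=
              mul_le_mul_of_nonneg_left (le_abs_self A) (by positivity)
          _ ≤ _ := mul_le_of_le_one_left (abs_nonneg _) (hn1 n)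
      have h3 := abs_sub_abs_le_abs_sub ((p n).eval (f x)) (β (f x))
      linarith
    · filter_upwards [hf] with x hx
      refine Tendsto.mul_const _ (tendsto_iff_dist_tendsto_zero.2 ?_)
      exact squeeze_zero (fun _ => dist_nonneg) (fun n => (hp n (f x) hx).2) (hz A)
  have L2 : Tendsto (fun n => ∫ x in Ω, inner ℝ ((p n).derivative.eval (f x) • F x) e * φ x) atTop
      (𝓝 (∫ x in Ω, inner ℝ (β' (f x) • F x) e * φ x)) := by
    simp only [real_inner_smul_left, mul_assoc]
    refine tendsto_integral_of_dominated_convergence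
      (fun x => (B' + 1) * |inner ℝ (F x) e * φ x|)
      (fun n => ((p n).derivative.continuous.comp_aestronglyMeasurable hfm).mul
        hFφ.aestronglyMeasurable)
      (hFφ.abs.const_mul _) (fun n => ?_) ?_
    · filter_upwards [hf, hB'] with x hx hbx
      rw [norm_mul, Real.norm_eq_abs, Real.norm_eq_abs]
      refine mul_le_mul_of_nonneg_right ?_ (abs_nonneg _)
      have h1 := (hp n (f x) hx).1
      have h3 := abs_sub_abs_le_abs_sub ((p n).derivative.eval (f x)) (β' (f x))
      linarith [hn1 n]
    · filter_upwards [hf] with x hx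
      refine Tendsto.mul_const _ (tendsto_iff_dist_tendsto_zero.2 ?_)
      exact squeeze_zero (fun _ => dist_nonneg) (fun n => (hp n (f x) hx).1)
        (by simpa using hz 1)
  refine tendsto_nhds_unique L1 (L2.neg.congr fun n => ?_)
  exact ((h.polynomial ho hfin hfm hf hF (p n)) φ hφ e).symm

/-- Composition with a `C¹` function maps bounded elements of `H¹(Ω)` to `H¹(Ω)`. -/
theorem H1.exists_comp {Ω : Set (Space d)} (ho : IsOpen Ω) (hfin : volume Ω ≠ ∞) (w : H1 Ω) {A : ℝ}
    (hw : ∀ᵐ x ∂(volume.restrict Ω), |w.val x| ≤ A)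
    {β β' : ℝ → ℝ} (hβ : ∀ s, HasDerivAt β (β' s) s) (hβ' : Continuous β') :
    ∃ ψ : H1 Ω, ψ.val =ᵐ[volume.restrict Ω] (fun x => β (w.val x)) ∧
      ψ.grad =ᵐ[volume.restrict Ω] fun x => β' (w.val x) • w.grad x := by
  have : IsFiniteMeasure (volume.restrict Ω) := ⟨by simpa using hfin.lt_top⟩
  have hβc : Continuous β := continuous_iff_continuousAt.2 fun s => (hβ s).continuousAt
  obtain ⟨B, -, -, hB⟩ := exists_bound_comp hw hβc
  obtain ⟨B', -, -, hB'⟩ := exists_bound_comp hw hβ'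
  have hwm : AEStronglyMeasurable w.val (volume.restrict Ω) := (Lp.memLp w.val).1
  have m1 : MemLp (fun x => β (w.val x)) 2 (volume.restrict Ω) :=
    MemLp.of_bound (hβc.comp_aestronglyMeasurable hwm) B hB
  have m2 : MemLp (fun x => β' (w.val x) • w.grad x) 2 (volume.restrict Ω) :=
    (Lp.memLp w.grad).of_le_mul (c := B')
      ((hβ'.comp_aestronglyMeasurable hwm).smul (Lp.memLp w.grad).1) (by
        filter_upwards [hB'] with x hx
        rw [norm_smul]
        exact mul_le_mul_of_nonneg_right hx (norm_nonneg _))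
  have hg : WeakGrad Ω w.val w.grad := w.2
  have hc := (hg.comp ho hfin hwm hw ((Lp.memLp w.grad).integrable (by norm_num)) hβ hβ').congr
    m1.coeFn_toLp m2.coeFn_toLp
  exact ⟨⟨WithLp.toLp 2 (m1.toLp _, m2.toLp _), hc⟩, m1.coeFn_toLp, m2.coeFn_toLp⟩

/-! ### Distributional derivatives on the half-line -/

/-- A smooth approximation of the Heaviside function with derivative `mollifier ℝ n`. -/
theorem exists_smooth_step (n : ℕ) : ∃ θ : ℝ → ℝ, ContDiff ℝ (⊤ : ℕ∞) θ ∧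
    (∀ x, HasDerivAt θ (mollifier ℝ n x) x) ∧ (∀ x, x ≤ -(1 / ((n : ℝ) + 1)) → θ x = 0) ∧
    (∀ x, 1 / ((n : ℝ) + 1) ≤ x → θ x = 1) ∧ ∀ x, 0 ≤ θ x ∧ θ x ≤ 1 := by
  have hχ := (contDiff_mollifier ℝ n).continuous
  have hn1 : 1 / ((n : ℝ) + 1) ≤ 1 := by
    rw [div_le_one (by positivity)]; linarith [(Nat.cast_nonneg n : (0 : ℝ) ≤ n)]
  have hn0 : 0 < 1 / ((n : ℝ) + 1) := by positivity
  have hd : ∀ x, HasDerivAt (fun x => ∫ y in (-2)..x, mollifier ℝ n y) (mollifier ℝ n x) x :=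
    fun x => (hχ.integral_hasStrictDerivAt (-2) x).hasDerivAt
  have h0 : ∀ x, x ≤ -(1 / ((n : ℝ) + 1)) → ∫ y in (-2)..x, mollifier ℝ n y = 0 := by
    intro x hx
    refine intervalIntegral.integral_zero_ae (Eventually.of_forall fun y hy => ?_)
    have hy' : y ≤ -(1 / ((n : ℝ) + 1)) := hy.2.trans (max_le (by linarith) hx)
    refine Function.notMem_support.1 fun h => ?_
    rw [support_mollifier, mem_ball_zero_iff, Real.norm_eq_abs, abs_lt] at h
    linarith [h.1]
  have h1 : ∀ x, 1 / ((n : ℝ) + 1) ≤ x → ∫ y in (-2)..x, mollifier ℝ n y = 1 := by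
    intro x hx
    rw [intervalIntegral.integral_eq_integral_of_support_subset, integral_mollifier]
    intro y hy
    rw [support_mollifier, mem_ball_zero_iff, Real.norm_eq_abs, abs_lt] at hy
    exact ⟨by linarith [hy.1], by linarith [hy.2]⟩
  have hmono : Monotone fun x => ∫ y in (-2)..x, mollifier ℝ n y :=
    monotone_of_deriv_nonneg (fun x => (hd x).differentiableAt)
      (fun x => by rw [(hd x).deriv]; exact mollifier_nonneg ℝ n x)
  refine ⟨_, ?_, hd, h0, h1, fun x => ⟨?_, ?_⟩⟩
  · rw [contDiff_infty_iff_deriv]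
    refine ⟨fun x => (hd x).differentiableAt, ?_⟩
    rw [show deriv (fun x => ∫ y in (-2)..x, mollifier ℝ n y) = mollifier ℝ n from
      funext fun x => (hd x).deriv]
    exact contDiff_mollifier ℝ n
  · rw [← h0 (min x (-(1 / ((n : ℝ) + 1)))) (min_le_right _ _)]
    exact hmono (min_le_left _ _)
  · rw [← h1 (max x (1 / ((n : ℝ) + 1))) (le_max_right _ _)]
    exact hmono (le_max_left _ _)

theorem tendsto_integral_mollifier_real {v : ℝ → ℝ} (hv : Continuous v) (s : ℝ) :
    Tendsto (fun n => ∫ τ, mollifier ℝ n (τ - s) * v τ) atTop (𝓝 (v s)) := by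
  have := ContDiffBump.convolution_tendsto_right_of_continuous (μ := (volume : Measure ℝ))
    (tendsto_bump_rOut ℝ) hv s
  refine this.congr fun n => ?_
  rw [convolution_lsmul_swap]
  congr 1; ext τ
  rw [mollifier_sub_comm, smul_eq_mul]
  rfl

/-- `w` is the distributional derivative of `v` on `(0, ∞)`. -/
def WeakDeriv (v w : ℝ → ℝ) : Prop :=
  ∀ ψ : ℝ → ℝ, ContDiff ℝ (⊤ : ℕ∞) ψ → HasCompactSupport ψ → tsupport ψ ⊆ Ioi 0 →
    ∫ t in Ioi (0 : ℝ), deriv ψ t * v t = -∫ t in Ioi (0 : ℝ), ψ t * w t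

theorem WeakDeriv.sub_eq_integral_of_pos {v w : ℝ → ℝ} (h : WeakDeriv v w)
    (hv : ContinuousOn v (Ici 0)) (hw : ∀ T, 0 < T → IntegrableOn w (Ioo 0 T)) {s t : ℝ}
    (hs : 0 < s) (hst : s < t) : v t - v s = ∫ τ in s..t, w τ := by
  choose θ hθs hθd hθ0 hθ1 hθb using exists_smooth_step
  -- a continuous function on the line that agrees with `v` on `[0, ∞)`
  set v' : ℝ → ℝ := fun τ => v (max τ 0) with hv'
  have hv'c : Continuous v' := hv.comp_continuous (by fun_prop) (fun τ => mem_Ici.2 (le_max_right _ _))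
  have hv'e : ∀ τ, 0 ≤ τ → v' τ = v τ := fun τ hτ => by simp [hv', max_eq_left hτ]
  have hT : 0 < t + 2 := by linarith
  have hev : ∀ᶠ n : ℕ in atTop, 1 / ((n : ℝ) + 1) < s :=
    tendsto_one_div_add_atTop_nhds_zero_nat.eventually_lt_const hs
  have hn1 : ∀ n : ℕ, 1 / ((n : ℝ) + 1) ≤ 1 := fun n => by
    rw [div_le_one (by positivity)]; linarith [(Nat.cast_nonneg n : (0 : ℝ) ≤ n)]
  have L1 : Tendsto (fun n => (∫ τ, mollifier ℝ n (τ - t) * v' τ)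
      - ∫ τ, mollifier ℝ n (τ - s) * v' τ) atTop (𝓝 (v t - v s)) := by
    rw [← hv'e t (by linarith), ← hv'e s hs.le]
    exact (tendsto_integral_mollifier_real hv'c t).sub (tendsto_integral_mollifier_real hv'c s)
  have hψ0 : ∀ (n : ℕ) τ, t + 1 / ((n : ℝ) + 1) ≤ τ → θ n (τ - s) - θ n (τ - t) = 0 := by
    intro n τ hτ
    rw [hθ1 n (τ - s) (by linarith), hθ1 n (τ - t) (by linarith), sub_self]
  have hψ0' : ∀ (n : ℕ) τ, τ ≤ s - 1 / ((n : ℝ) + 1) → θ n (τ - s) - θ n (τ - t) = 0 := by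
    intro n τ hτ
    rw [hθ0 n (τ - s) (by linarith), hθ0 n (τ - t) (by linarith), sub_self]
  have L2 : Tendsto (fun n => ∫ τ in Ioi (0 : ℝ), (θ n (τ - s) - θ n (τ - t)) * w τ) atTop
      (𝓝 (∫ τ in Ioi (0 : ℝ), (Ioc s t).indicator w τ)) := by
    refine tendsto_integral_of_dominated_convergence ((Ioo 0 (t + 2)).indicator fun τ => |w τ|)
      (fun n => ?_) ?_ (fun n => ?_) ?_
    · have hc : Continuous fun τ => θ n (τ - s) - θ n (τ - t) :=
        ((hθs n).continuous.comp (continuous_id.sub continuous_const)).sub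
          ((hθs n).continuous.comp (continuous_id.sub continuous_const))
      have hi : IntegrableOn ((Ioo 0 (t + 2)).indicator fun τ => (θ n (τ - s) - θ n (τ - t)) * w τ)
          (Ioi 0) := by
        refine IntegrableOn.integrable_indicator ?_ measurableSet_Ioo |>.integrableOn
        exact (hw _ hT).bdd_mul (c := 1) hc.aestronglyMeasurable (Eventually.of_forall fun τ => by
          rw [Real.norm_eq_abs, abs_le]
          constructor <;> linarith [hθb n (τ - s), hθb n (τ - t)])
      refine hi.aestronglyMeasurable.congr ?_
      filter_upwards [ae_restrict_mem measurableSet_Ioi] with τ hτ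
      by_cases hτ' : τ ∈ Ioo 0 (t + 2)
      · rw [indicator_of_mem hτ']
      · rw [indicator_of_notMem hτ', hψ0 n τ, zero_mul]
        have : t + 2 ≤ τ := by
          by_contra! hc'
          exact hτ' ⟨hτ, hc'⟩
        linarith [hn1 n]
    · exact (IntegrableOn.integrable_indicator (hw _ hT).abs measurableSet_Ioo).integrableOn
    · filter_upwards [ae_restrict_mem measurableSet_Ioi] with τ hτ
      by_cases hτ' : τ ∈ Ioo 0 (t + 2)
      · rw [indicator_of_mem hτ', norm_mul, Real.norm_eq_abs, Real.norm_eq_abs]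
        refine mul_le_of_le_one_left (abs_nonneg _) ?_
        rw [abs_le]
        constructor <;> linarith [hθb n (τ - s), hθb n (τ - t)]
      · rw [indicator_of_notMem hτ', hψ0 n τ, zero_mul, norm_zero]
        have : t + 2 ≤ τ := by
          by_contra! hc'
          exact hτ' ⟨hτ, hc'⟩
        linarith [hn1 n]
    · have hne : ∀ᵐ τ : ℝ, τ ≠ s ∧ τ ≠ t := by
        filter_upwards [(Set.finite_singleton s).measure_zero volume |> compl_mem_ae_iff.2,
          (Set.finite_singleton t).measure_zero volume |> compl_mem_ae_iff.2] with τ h1 h2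
        exact ⟨h1, h2⟩
      filter_upwards [ae_restrict_of_ae hne] with τ hτ
      have hlim : ∀ a, a ≠ 0 → ∀ᶠ n : ℕ in atTop, θ n a = if 0 < a then 1 else 0 := by
        intro a ha
        filter_upwards [tendsto_one_div_add_atTop_nhds_zero_nat.eventually_lt_const
          (abs_pos.2 ha)] with n hn
        split_ifs with h0
        · rw [abs_of_pos h0] at hn
          exact hθ1 n a hn.le
        · rw [abs_of_nonpos (not_lt.1 h0)] at hn
          exact hθ0 n a (by linarith)
      refine tendsto_const_nhds.congr' ?_
      filter_upwards [hlim (τ - s) (sub_ne_zero.2 hτ.1), hlim (τ - t) (sub_ne_zero.2 hτ.2)]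
        with n e1 e2
      rw [e1, e2]
      by_cases c1 : s < τ
      · by_cases c2 : τ ≤ t
        · rw [indicator_of_mem (show τ ∈ Ioc s t from ⟨c1, c2⟩), if_pos (by linarith),
            if_neg (by linarith)]
          ring
        · rw [indicator_of_notMem (fun hc => c2 hc.2), if_pos (by linarith),
            if_pos (by linarith)]
          ring
      · rw [indicator_of_notMem (fun hc => c1 hc.1), if_neg (by linarith),
          if_neg (by linarith)]
        ring
  have hR : ∫ τ in Ioi (0 : ℝ), (Ioc s t).indicator w τ = ∫ τ in s..t, w τ := by
    rw [intervalIntegral.integral_of_le hst.le, setIntegral_indicator measurableSet_Ioc]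
    congr 2
    ext τ
    simp only [mem_inter_iff, mem_Ioi, mem_Ioc]
    constructor
    · exact fun h => h.2
    · exact fun h => ⟨hs.trans h.1, h⟩
  rw [← hR]
  refine tendsto_nhds_unique (L1.congr' ?_) L2
  filter_upwards [hev] with n hn
  have hd : ∀ τ, HasDerivAt (fun τ => θ n (τ - s) - θ n (τ - t))
      (mollifier ℝ n (τ - s) - mollifier ℝ n (τ - t)) τ := fun τ =>
    ((hθd n _).comp_sub_const τ s).sub ((hθd n _).comp_sub_const τ t)
  have hsub : tsupport (fun τ => θ n (τ - s) - θ n (τ - t)) ⊆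
      Icc (s - 1 / ((n : ℝ) + 1)) (t + 1 / ((n : ℝ) + 1)) := by
    refine closure_minimal (fun τ hτ => ⟨?_, ?_⟩) isClosed_Icc
    · by_contra! hc
      exact hτ (hψ0' n τ hc.le)
    · by_contra! hc
      exact hτ (hψ0 n τ hc.le)
  have ht := h (fun τ => θ n (τ - s) - θ n (τ - t))
    (((hθs n).comp (contDiff_id.sub contDiff_const)).sub
      ((hθs n).comp (contDiff_id.sub contDiff_const)))
    (IsCompact.of_isClosed_subset isCompact_Icc (isClosed_tsupport _) hsub)
    (hsub.trans fun τ hτ => by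
      have := hτ.1
      simp only [mem_Ioi]; linarith)
  rw [eq_neg_iff_add_eq_zero, add_comm, ← eq_neg_iff_add_eq_zero] at ht
  rw [ht]
  have hint : ∀ a, Integrable fun τ => mollifier ℝ n (τ - a) * v' τ := fun a =>
    Continuous.integrable_of_hasCompactSupport
      (((contDiff_mollifier ℝ n).continuous.comp (continuous_id.sub continuous_const)).mul hv'c)
      (HasCompactSupport.mul_right
        ((hasCompactSupport_mollifier ℝ n).comp_homeomorph (Homeomorph.subRight a)))
  have hmol : ∀ a τ, s ≤ a → τ ∉ Ioi (0 : ℝ) → mollifier ℝ n (τ - a) = 0 := by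
    intro a τ ha hτ
    refine Function.notMem_support.1 fun hc => ?_
    rw [support_mollifier, mem_ball_zero_iff, Real.norm_eq_abs, abs_lt] at hc
    simp only [mem_Ioi, not_lt] at hτ
    linarith [hc.1]
  have e1 : ∫ τ in Ioi (0 : ℝ), deriv (fun τ => θ n (τ - s) - θ n (τ - t)) τ * v τ
      = ∫ τ, (mollifier ℝ n (τ - s) * v' τ - mollifier ℝ n (τ - t) * v' τ) := by
    rw [← setIntegral_eq_integral_of_forall_compl_eq_zero (s := Ioi (0 : ℝ))
      (f := fun τ => mollifier ℝ n (τ - s) * v' τ - mollifier ℝ n (τ - t) * v' τ)]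
    · refine setIntegral_congr_fun measurableSet_Ioi fun τ hτ => ?_
      simp only [(hd τ).deriv, hv'e τ (le_of_lt hτ)]
      ring
    · intro τ hτ
      rw [hmol s τ le_rfl hτ, hmol t τ hst.le hτ]; ring
  rw [e1, integral_sub (hint s) (hint t)]
  ring

/-- A continuous function on `[0, ∞)` with a locally integrable distributional derivative is the
integral of that derivative. -/
theorem WeakDeriv.sub_eq_integral {v w : ℝ → ℝ} (h : WeakDeriv v w)
    (hv : ContinuousOn v (Ici 0)) (hw : ∀ T, 0 < T → IntegrableOn w (Ioo 0 T)) {s t : ℝ}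
    (hs : 0 ≤ s) (hst : s ≤ t) : v t - v s = ∫ τ in s..t, w τ := by
  rcases hst.eq_or_lt with rfl | hst
  · simp
  have hint : IntegrableOn w (Icc 0 t) := by
    rw [integrableOn_Icc_iff_integrableOn_Ioo]
    exact hw t (hs.trans_lt hst)
  have hc : ContinuousOn (fun x => v t - v x - ∫ τ in x..t, w τ) (Icc 0 t) := by
    refine (continuousOn_const.sub (hv.mono fun x hx => hx.1)).sub ?_
    have := intervalIntegral.continuousOn_primitive_interval_left (μ := volume) (f := w)
      (a := 0) (b := t) (by rwa [uIcc_of_le (hs.trans hst.le)])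
    rwa [uIcc_of_le (hs.trans hst.le)] at this
  -- both sides are continuous in `s`, and they agree for `s > 0`
  have hz : ∀ x ∈ Ioo 0 t, v t - v x - ∫ τ in x..t, w τ = 0 := fun x hx => by
    rw [h.sub_eq_integral_of_pos hv hw hx.1 hx.2, sub_self]
  have hcl : s ∈ closure (Ioo 0 t) := by
    rw [closure_Ioo (hs.trans_lt hst).ne]
    exact ⟨hs, hst.le⟩
  have : v t - v s - ∫ τ in s..t, w τ = 0 := by
    have hne : (𝓝[Ioo 0 t] s).NeBot := mem_closure_iff_nhdsWithin_neBot.1 hcl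
    have t1 := (hc s ⟨hs, hst.le⟩).mono Ioo_subset_Icc_self
    have t2 : Tendsto (fun x => v t - v x - ∫ τ in x..t, w τ) (𝓝[Ioo 0 t] s) (𝓝 0) :=
      tendsto_const_nhds.congr' (eventually_nhdsWithin_of_forall fun x hx => (hz x hx).symm)
    exact tendsto_nhds_unique t1 t2
  linarith

/-- The product rule for an exponential weight. -/
theorem WeakDeriv.exp_mul {v w : ℝ → ℝ} (h : WeakDeriv v w) (hv : ContinuousOn v (Ici 0))
    (hw : ∀ T, 0 < T → IntegrableOn w (Ioo 0 T)) (a : ℝ) :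
    WeakDeriv (fun t => Real.exp (a * t) * v t) (fun t => Real.exp (a * t) * (w t + a * v t)) := by
  intro ψ hψ hψc hψs
  have hE : ContDiff ℝ (⊤ : ℕ∞) fun t => Real.exp (a * t) := by fun_prop
  have hEd : ∀ t, HasDerivAt (fun t => Real.exp (a * t)) (Real.exp (a * t) * a) t := fun t => by
    simpa using ((hasDerivAt_id t).const_mul a).exp
  have ht := h (fun t => Real.exp (a * t) * ψ t) (hE.mul hψ) hψc.mul_left
    (tsupport_mul_subset_right.trans hψs)
  have hd : ∀ t, deriv (fun t => Real.exp (a * t) * ψ t) t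
      = Real.exp (a * t) * a * ψ t + Real.exp (a * t) * deriv ψ t := fun t =>
    ((hEd t).mul ((hψ.differentiable (by simp)) t).hasDerivAt).deriv
  -- test functions times locally integrable functions are integrable on `(0, ∞)`
  have hI : ∀ {η f : ℝ → ℝ}, Continuous η → tsupport η ⊆ tsupport ψ →
      (∀ T, 0 < T → IntegrableOn f (Ioo 0 T)) → IntegrableOn (fun t => η t * f t) (Ioi 0) := by
    intro η f hη hηs hf
    have hηc : HasCompactSupport η := IsCompact.of_isClosed_subset hψc (isClosed_tsupport _) hηs
    obtain ⟨R, hR⟩ := hηc.isCompact.isBounded.subset_ball 0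
    obtain ⟨C, hC⟩ := hη.bounded_above_of_compact_support hηc
    have hz : ∀ t, t ∉ Ioo 0 (max R 1) → η t * f t = 0 := by
      intro t ht
      suffices t ∉ tsupport η by rw [image_eq_zero_of_notMem_tsupport this, zero_mul]
      intro hc
      have h1 := hψs (hηs hc)
      have h2 := hR hc
      rw [mem_ball_zero_iff, Real.norm_eq_abs, abs_lt] at h2
      exact ht ⟨h1, h2.2.trans_le (le_max_left _ _)⟩
    have h3 : IntegrableOn (fun t => η t * f t) (Ioo 0 (max R 1)) :=
      (hf _ (by positivity)).bdd_mul (c := C) hη.aestronglyMeasurable (Eventually.of_forall hC)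
    exact (h3.integrable_of_forall_notMem_eq_zero hz).integrableOn
  have hvI : ∀ T, 0 < T → IntegrableOn v (Ioo 0 T) := fun T _ =>
    ((hv.mono fun x hx => hx.1 : ContinuousOn v (Icc 0 T)).integrableOn_Icc).mono_set
      Ioo_subset_Icc_self
  have i1 : IntegrableOn (fun t => Real.exp (a * t) * a * ψ t * v t) (Ioi 0) :=
    hI (by have := hψ.continuous; fun_prop) tsupport_mul_subset_right hvI
  have i2 : IntegrableOn (fun t => Real.exp (a * t) * deriv ψ t * v t) (Ioi 0) :=
    hI (by have := hψ.continuous_deriv (by simp); fun_prop)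
      (tsupport_mul_subset_right.trans tsupport_deriv_subset) hvI
  have i3 : IntegrableOn (fun t => Real.exp (a * t) * ψ t * w t) (Ioi 0) :=
    hI (by have := hψ.continuous; fun_prop) tsupport_mul_subset_right hw
  simp only [hd, add_mul] at ht
  rw [integral_add i1 i2] at ht
  have e1 : ∫ t in Ioi (0 : ℝ), deriv ψ t * (Real.exp (a * t) * v t)
      = ∫ t in Ioi (0 : ℝ), Real.exp (a * t) * deriv ψ t * v t := by
    congr 1; ext t; ring
  have e2 : ∫ t in Ioi (0 : ℝ), ψ t * (Real.exp (a * t) * (w t + a * v t))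
      = (∫ t in Ioi (0 : ℝ), Real.exp (a * t) * ψ t * w t)
        + ∫ t in Ioi (0 : ℝ), Real.exp (a * t) * a * ψ t * v t := by
    rw [← integral_add i3 i1]
    congr 1; ext t; ring
  rw [e1, e2]
  linarith

/-! ### A discrete energy inequality in time -/

section Translation

variable {E : Type*} [NormedAddCommGroup E]

/-- Translations are continuous in `L²(ℝ)`. -/
theorem tendsto_eLpNorm_translate {k : ℝ → E} (hk : MemLp k 2 volume) :
    Tendsto (fun r => eLpNorm (fun t => k (t - r) - k t) 2 volume) (𝓝 0) (𝓝 0) := by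
  let g : ℝ → C(ℝ, ℝ) := fun r => ⟨fun t => t - r, by fun_prop⟩
  have hg : Continuous g := ContinuousMap.continuous_of_continuous_uncurry _
    (by simp only [g, Function.uncurry_def, ContinuousMap.coe_mk]; fun_prop)
  have hgm : ∀ r, MeasurePreserving (g r) volume volume := fun r =>
    measurePreserving_sub_right volume r
  have := (Filter.Tendsto.compMeasurePreservingLp (l := 𝓝 0) (tendsto_const_nhds (x := hk.toLp k))
    (hg.tendsto 0) hgm (hgm 0) (by simp))
  have h2 := (Lp.tendsto_Lp_iff_tendsto_eLpNorm'' (fun r t => k (t - r))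
    (fun r => hk.comp_measurePreserving (hgm r)) (fun t => k (t - 0))
    (hk.comp_measurePreserving (hgm 0))).1 this
  refine h2.congr fun r => ?_
  congr 1; ext t
  simp

/-- If the backward increments of `J` are controlled by the oscillation of a square-integrable
function `k` at scale `h`, then `J` does not increase from time `0` to times arbitrarily close
to `T`. Integrating the increments over `(0, T)` telescopes to averages of `J` near `T` and at `0`,
whereas the right-hand side is `o(h)` by continuity of translations in `L²`. -/
theorem exists_le_of_increment_le [NormedSpace ℝ E] {k : ℝ → E} (hk : MemLp k 2 volume) {T : ℝ}
    (hT : 0 < T) {B : ℝ → ℝ} (hB : MemLp B 2 (volume.restrict (Ioo 0 T))) {J : ℝ → ℝ}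
    (hJm : AEStronglyMeasurable J (volume.restrict (Ioo 0 T))) {C : ℝ}
    (hJb : ∀ᵐ t ∂(volume.restrict (Ioo 0 T)), |J t| ≤ C)
    (hinc : ∀ h, 0 < h → ∀ᵐ t ∂(volume.restrict (Ioo 0 T)),
      ENNReal.ofReal (J t - J (max (t - h) 0))
        ≤ ‖B t‖ₑ * ∫⁻ r in Ioc 0 h, ‖k (t - r) - k t‖ₑ)
    {P : ℝ → Prop} (hP : ∀ᵐ t ∂(volume.restrict (Ioo 0 T)), P t) {ε δ : ℝ} (hε : 0 < ε)
    (hδ : 0 < δ) : ∃ t ∈ Ioo 0 T, T - δ < t ∧ P t ∧ J t ≤ J 0 + ε := by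
  by_contra! hcon
  obtain ⟨η, hη, hBη⟩ : ∃ η : ℝ≥0∞, 0 < η ∧
      eLpNorm B 2 (volume.restrict (Ioo 0 T)) * η ≤ ENNReal.ofReal (ε / 2) := by
    refine ⟨ENNReal.ofReal (ε / 2) / (eLpNorm B 2 (volume.restrict (Ioo 0 T)) + 1), ?_, ?_⟩
    · refine ENNReal.div_pos (by simpa using hε) ?_
      simpa using hB.2.ne
    · rw [← mul_div_assoc, mul_comm]
      refine ENNReal.div_le_of_le_mul ?_
      gcongr
      exact le_self_add
  obtain ⟨r₀, hr₀, hkr⟩ := Metric.eventually_nhds_iff.1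
    ((tendsto_eLpNorm_translate hk).eventually_lt_const hη)
  obtain ⟨h, hh0, hh⟩ : ∃ h, 0 < h ∧ h < min (min r₀ δ) T :=
    exists_between (lt_min (lt_min hr₀ hδ) hT)
  have hhr : h < r₀ := hh.trans_le ((min_le_left _ _).trans (min_le_left _ _))
  have hhδ : h < δ := hh.trans_le ((min_le_left _ _).trans (min_le_right _ _))
  have hhT : h < T := hh.trans_le (min_le_right _ _)
  -- `J`, extended to negative times by its value at `0`
  set J' : ℝ → ℝ := fun s => J (max s 0) with hJ'
  have hJe : ∀ t, 0 ≤ t → J' t = J t := fun t ht => by simp [hJ', max_eq_left ht]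
  have hJe0 : ∀ t, t ≤ 0 → J' t = J 0 := fun t ht => by simp [hJ', max_eq_right ht]
  have hI0 : IntervalIntegrable J' volume 0 T := by
    rw [intervalIntegrable_iff_integrableOn_Ioo_of_le hT.le]
    refine IntegrableOn.congr_fun (f := J) ?_ (fun t ht => (hJe t ht.1.le).symm) measurableSet_Ioo
    exact Integrable.of_bound hJm C hJb
  have hI1 : IntervalIntegrable J' volume (-h) 0 := by
    rw [intervalIntegrable_iff_integrableOn_Ioo_of_le (by linarith)]
    refine IntegrableOn.congr_fun (f := fun _ => J 0) ?_
      (fun t ht => (hJe0 t ht.2.le).symm) measurableSet_Ioo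
    simp
  have hI2 : IntervalIntegrable J' volume (-h) T := hI1.trans hI0
  have hI3 : ∀ a b, -h ≤ a → a ≤ b → b ≤ T → IntervalIntegrable J' volume a b := fun a b h1 h2 h3 =>
    hI2.mono_set (by
      rw [uIcc_of_le h2, uIcc_of_le (by linarith)]
      exact Icc_subset_Icc h1 h3)
  have hsh : IntervalIntegrable (fun t => J' (t - h)) volume 0 T := by
    have := (hI3 (-h) (T - h) le_rfl (by linarith) (by linarith)).comp_sub_right h
    simpa using this
  -- telescoping
  have e1 : ∫ t in (0)..T, (J' t - J' (t - h))
      = (∫ t in (T - h)..T, J' t) - ∫ t in (-h)..0, J' t := by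
    rw [intervalIntegral.integral_sub hI0 hsh, intervalIntegral.integral_comp_sub_right,
      zero_sub, ← intervalIntegral.integral_add_adjacent_intervals (b := T - h)
        (hI3 0 (T - h) (by linarith) (by linarith) (by linarith))
        (hI3 (T - h) T (by linarith) (by linarith) le_rfl),
      ← intervalIntegral.integral_add_adjacent_intervals (a := -h) (b := 0) (c := T - h)
        hI1 (hI3 0 (T - h) (by linarith) (by linarith) (by linarith))]
    ring
  have e2 : ∫ t in (-h)..0, J' t = h * J 0 := by
    rw [intervalIntegral.integral_congr (g := fun _ => J 0)
      (fun t ht => hJe0 t (by rw [uIcc_of_le (by linarith)] at ht; exact ht.2))]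
    simp
  have e3 : h * (J 0 + ε) ≤ ∫ t in (T - h)..T, J' t := by
    have hle : ∫ t in (T - h)..T, (J 0 + ε) ≤ ∫ t in (T - h)..T, J' t := by
      refine intervalIntegral.integral_mono_ae_restrict (by linarith) (by simp)
        (hI3 (T - h) T (by linarith) (by linarith) le_rfl) ?_
      have hsub : volume.restrict (Icc (T - h) T) ≪ volume.restrict (Ioo 0 T) := by
        rw [← restrict_Ioo_eq_restrict_Icc]
        exact (Measure.restrict_mono (Ioo_subset_Ioo_left (by linarith)) le_rfl).absolutelyContinuous
      filter_upwards [hsub.ae_le hP, hsub.ae_le (ae_restrict_mem measurableSet_Ioo),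
        ae_restrict_mem measurableSet_Icc] with t h1 h2 h3
      rw [hJe t h2.1.le]
      exact (hcon t h2 (by linarith [h3.1]) h1).le
    simpa [mul_add] using hle
  -- the upper bound
  have hF : IntegrableOn (fun t => J' t - J' (t - h)) (Ioo 0 T) := by
    rw [← intervalIntegrable_iff_integrableOn_Ioo_of_le hT.le]
    exact hI0.sub hsh
  have hμ : ∀ r, AEStronglyMeasurable (fun t => k (t - r) - k t) volume := fun r =>
    (hk.1.comp_measurePreserving (measurePreserving_sub_right volume r)).sub hk.1
  have hb : ∫⁻ t in Ioo 0 T, ENNReal.ofReal (J' t - J' (t - h)) ≤ ENNReal.ofReal (h * (ε / 2)) := by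
    calc ∫⁻ t in Ioo 0 T, ENNReal.ofReal (J' t - J' (t - h))
        ≤ ∫⁻ t in Ioo 0 T, ∫⁻ r in Ioc 0 h, ‖B t‖ₑ * ‖k (t - r) - k t‖ₑ := by
          refine lintegral_mono_ae ?_
          filter_upwards [hinc h hh0, ae_restrict_mem measurableSet_Ioo] with t h1 h2
          rw [hJe t h2.1.le]
          refine h1.trans (le_of_eq ?_)
          rw [lintegral_const_mul' _ _ enorm_ne_top]
      _ = ∫⁻ r in Ioc 0 h, ∫⁻ t in Ioo 0 T, ‖B t‖ₑ * ‖k (t - r) - k t‖ₑ := by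
          refine lintegral_lintegral_swap ?_
          have m1 : AEStronglyMeasurable (fun z : ℝ × ℝ => B z.1)
              ((volume.restrict (Ioo 0 T)).prod (volume.restrict (Ioc 0 h))) := hB.1.comp_fst
          have m2 : AEStronglyMeasurable (fun z : ℝ × ℝ => k z.1)
              ((volume.restrict (Ioo 0 T)).prod (volume.restrict (Ioc 0 h))) :=
            hk.1.restrict.comp_fst
          have m3 : AEStronglyMeasurable (fun z : ℝ × ℝ => k (z.1 - z.2))
              ((volume.restrict (Ioo 0 T)).prod (volume.restrict (Ioc 0 h))) := by
            rw [Measure.prod_restrict]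
            exact (hk.1.comp_quasiMeasurePreserving
              (quasiMeasurePreserving_sub_of_right_invariant volume volume)).restrict
          exact m1.enorm.mul (m3.sub m2).enorm
      _ ≤ ∫⁻ r in Ioc 0 h, ENNReal.ofReal (ε / 2) := by
          refine lintegral_mono_ae ?_
          filter_upwards [ae_restrict_mem measurableSet_Ioc] with r hr
          calc ∫⁻ t in Ioo 0 T, ‖B t‖ₑ * ‖k (t - r) - k t‖ₑ
              = eLpNorm (B • fun t => k (t - r) - k t) 1 (volume.restrict (Ioo 0 T)) := by
                rw [eLpNorm_one_eq_lintegral_enorm]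
                simp only [Pi.smul_apply', enorm_smul]
            _ ≤ eLpNorm B 2 (volume.restrict (Ioo 0 T))
                * eLpNorm (fun t => k (t - r) - k t) 2 (volume.restrict (Ioo 0 T)) :=
                eLpNorm_smul_le_mul_eLpNorm (hμ r).restrict hB.1
            _ ≤ eLpNorm B 2 (volume.restrict (Ioo 0 T)) * η := by
                gcongr
                refine (eLpNorm_mono_measure _ Measure.restrict_le_self).trans (hkr ?_).le
                rw [dist_zero_right, Real.norm_eq_abs, abs_of_pos hr.1]
                exact hr.2.trans_lt hhr
            _ ≤ _ := hBη
      _ = ENNReal.ofReal (h * (ε / 2)) := by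
          rw [setLIntegral_const, Real.volume_Ioc, sub_zero, mul_comm,
            ENNReal.ofReal_mul hh0.le]
  have e4 : ∫ t in (0)..T, (J' t - J' (t - h)) ≤ h * (ε / 2) := by
    rw [intervalIntegral.integral_of_le hT.le, integral_Ioc_eq_integral_Ioo,
      integral_eq_lintegral_pos_part_sub_lintegral_neg_part hF]
    have h1 := ENNReal.toReal_mono ENNReal.ofReal_ne_top hb
    rw [ENNReal.toReal_ofReal (by positivity)] at h1
    have h2 : 0 ≤ (∫⁻ t in Ioo 0 T, ENNReal.ofReal (-(J' t - J' (t - h)))).toReal :=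
      ENNReal.toReal_nonneg
    linarith
  have : 0 < h * (ε / 2) := by positivity
  nlinarith

end Translation

/-! ### Density of `H¹(Ω)` and weak limits in `L²(Ω)` -/

/-- The inclusion `H¹(Ω) → L²(Ω)`. -/
noncomputable def H1.valL (Ω : Set (Space d)) : H1 Ω →L[ℝ] L2 Ω :=
  (WithLp.fstL 2 ℝ (L2 Ω) (L2Vec Ω)).comp (sobolevGraph Ω).subtypeL

theorem H1.val_smul {Ω : Set (Space d)} (a : ℝ) (φ : H1 Ω) : (a • φ).val = a • φ.val := rfl

theorem H1.grad_smul {Ω : Set (Space d)} (a : ℝ) (φ : H1 Ω) : (a • φ).grad = a • φ.grad := rfl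

theorem H1.norm_val_le {Ω : Set (Space d)} (φ : H1 Ω) : ‖φ.val‖ ≤ ‖φ‖ :=
  abs_le_of_sq_le_sq' (by nlinarith [φ.norm_sq, sq_nonneg ‖φ.grad‖]) (norm_nonneg φ) |>.2

theorem H1.norm_grad_le {Ω : Set (Space d)} (φ : H1 Ω) : ‖φ.grad‖ ≤ ‖φ‖ :=
  abs_le_of_sq_le_sq' (by nlinarith [φ.norm_sq, sq_nonneg ‖φ.val‖]) (norm_nonneg φ) |>.2

theorem H1.norm_le {Ω : Set (Space d)} (φ : H1 Ω) : ‖φ‖ ≤ ‖φ.val‖ + ‖φ.grad‖ :=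
  abs_le_of_sq_le_sq' (by
    nlinarith [φ.norm_sq, mul_nonneg (norm_nonneg φ.val) (norm_nonneg φ.grad)])
    (by positivity) |>.2

theorem inner_eq_setIntegral {Ω : Set (Space d)} (f g : L2 Ω) :
    inner ℝ f g = ∫ x in Ω, f x * g x := by
  rw [L2.inner_def]
  congr 1; ext x
  simp [mul_comm]

theorem IsTestFunction.exists_H1 {Ω : Set (Space d)} {φ : Space d → ℝ} (h : IsTestFunction Ω φ) :
    ∃ ψ : H1 Ω, ψ.val =ᵐ[volume.restrict Ω] φ := by
  have hgc : Continuous (gradient φ) :=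
     (InnerProductSpace.toDual ℝ (Space d)).symm.continuous.comp
      (h.1.continuous_fderiv (by simp))
  have hgk : HasCompactSupport (gradient φ) :=
    (h.2.1.fderiv ℝ).comp_left (g := (InnerProductSpace.toDual ℝ (Space d)).symm) (map_zero _)
  have m1 : MemLp φ 2 (volume.restrict Ω) := (h.1.continuous.memLp_of_hasCompactSupport h.2.1)
  have m2 : MemLp (gradient φ) 2 (volume.restrict Ω) := hgc.memLp_of_hasCompactSupport hgk
  have hinn : ∀ x e, inner ℝ (gradient φ x) e = fderiv ℝ φ x e := fun x e => by
    rw [gradient, InnerProductSpace.toDual_symm_apply]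
  have hw : WeakGrad Ω φ (gradient φ) := by
    intro η hη e
    have s1 : ∀ x, x ∉ Ω → φ x * fderiv ℝ η x e = 0 := fun x hx => by
      rw [image_eq_zero_of_notMem_tsupport (fun hc => hx (h.2.2 hc)), zero_mul]
    have s2 : ∀ x, x ∉ Ω → inner ℝ (gradient φ x) e * η x = 0 := fun x hx => by
      rw [image_eq_zero_of_notMem_tsupport (f := η) (fun hc => hx (hη.2.2 hc)), mul_zero]
    rw [setIntegral_eq_integral_of_forall_compl_eq_zero s1,
      setIntegral_eq_integral_of_forall_compl_eq_zero s2]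
    simp only [hinn]
    have c1 := h.continuous_fderiv_apply e
    have c2 := hη.continuous_fderiv_apply e
    refine integral_mul_fderiv_eq_neg_fderiv_mul_of_integrable ?_ ?_ ?_
      (fun x _ => h.1.differentiable (by simp) x) (fun x _ => hη.1.differentiable (by simp) x)
    · exact (c1.mul hη.1.continuous).integrable_of_hasCompactSupport hη.2.1.mul_left
    · exact (h.1.continuous.mul c2).integrable_of_hasCompactSupport h.2.1.mul_right
    · exact (h.1.continuous.mul hη.1.continuous).integrable_of_hasCompactSupport hη.2.1.mul_left
  exact ⟨⟨WithLp.toLp 2 (m1.toLp _, m2.toLp _), hw.congr m1.coeFn_toLp m2.coeFn_toLp⟩,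
    m1.coeFn_toLp⟩

/-- `H¹(Ω)` is dense in `L²(Ω)`. -/
theorem H1.denseRange_valL {Ω : Set (Space d)} (ho : IsOpen Ω) : DenseRange (H1.valL Ω) := by
  have : (LinearMap.range (H1.valL Ω).toLinearMap).topologicalClosure = ⊤ := by
    rw [Submodule.topologicalClosure_eq_top_iff, Submodule.eq_bot_iff]
    intro f hf
    have h0 : ∀ φ : H1 Ω, inner ℝ f φ.val = 0 := fun φ => by
      rw [real_inner_comm]
      exact (Submodule.mem_orthogonal _ f).1 hf _ ⟨φ, rfl⟩
    have hloc : LocallyIntegrableOn f Ω (volume.restrict Ω) :=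
      ((Lp.memLp f).locallyIntegrable (by norm_num)).locallyIntegrableOn _
    have h1 := ho.ae_eq_zero_of_integral_contDiff_smul_eq_zero (μ := volume.restrict Ω) hloc
      (fun φ h1 h2 h3 => by
        obtain ⟨ψ, hψ⟩ := IsTestFunction.exists_H1 (Ω := Ω) ⟨h1, h2, h3⟩
        rw [← h0 ψ, inner_eq_setIntegral]
        refine integral_congr_ae ?_
        filter_upwards [hψ] with x hx
        rw [hx, smul_eq_mul, mul_comm])
    rw [Lp.eq_zero_iff_ae_eq_zero]
    filter_upwards [h1, ae_restrict_mem ho.measurableSet] with x hx hxΩ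
    exact hx hxΩ
  rw [DenseRange, dense_iff_closure_eq]
  exact (Submodule.topologicalClosure_coe _).symm.trans (by rw [this, Submodule.top_coe])

/-- A bounded sequence that converges weakly against a dense set of test vectors converges
weakly. -/
theorem tendsto_inner_of_dense {H : Type*} [NormedAddCommGroup H] [InnerProductSpace ℝ H]
    {S : Set H} (hS : Dense S) {w : ℕ → H} {w₀ : H} {R : ℝ} (hR : ∀ n, ‖w n‖ ≤ R)
    (h : ∀ φ ∈ S, Tendsto (fun n => inner ℝ (w n) φ) atTop (𝓝 (inner ℝ w₀ φ))) (ψ : H) :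
    Tendsto (fun n => inner ℝ (w n) ψ) atTop (𝓝 (inner ℝ w₀ ψ)) := by
  have hR0 : 0 ≤ R := (norm_nonneg _).trans (hR 0)
  rw [Metric.tendsto_atTop]
  intro ε hε
  obtain ⟨φ, hφS, hφ⟩ := hS.exists_dist_lt ψ (ε := ε / (2 * (R + ‖w₀‖ + 1))) (by positivity)
  obtain ⟨N, hN⟩ := Metric.tendsto_atTop.1 (h φ hφS) (ε / 2) (by positivity)
  refine ⟨N, fun n hn => ?_⟩
  have h1 := hN n hn
  rw [Real.dist_eq, ← inner_sub_left] at h1 ⊢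
  have h2 : inner ℝ (w n - w₀) ψ = inner ℝ (w n - w₀) φ + inner ℝ (w n - w₀) (ψ - φ) := by
    rw [← inner_add_right]; congr 1; abel
  have h3 : |inner ℝ (w n - w₀) (ψ - φ)| ≤ (R + ‖w₀‖) * ‖ψ - φ‖ :=
    (abs_real_inner_le_norm _ _).trans (mul_le_mul_of_nonneg_right
      ((norm_sub_le _ _).trans (by linarith [hR n])) (norm_nonneg _))
  have h4 : (R + ‖w₀‖) * ‖ψ - φ‖ ≤ ε / 2 := by
    rw [dist_eq_norm, lt_div_iff₀ (by positivity)] at hφ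
    nlinarith [norm_nonneg (ψ - φ), norm_nonneg w₀]
  rw [h2]
  calc _ ≤ |inner ℝ (w n - w₀) φ| + |inner ℝ (w n - w₀) (ψ - φ)| := abs_add_le _ _
    _ < ε := by linarith

section Bounded

variable {Ω : Set (Space d)} [IsFiniteMeasure (volume.restrict Ω)]

theorem norm_L2_le {f : L2 Ω} {A : ℝ} (hf : ∀ᵐ x ∂(volume.restrict Ω), |f x| ≤ A) (hA : 0 ≤ A) :
    ‖f‖ ≤ (measureUnivNNReal (volume.restrict Ω) : ℝ) ^ (2 : ℝ)⁻¹ * A := by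
  simpa using Lp.norm_le_of_ae_bound (p := 2) (f := f) hA hf

theorem integrable_comp {f : L2 Ω} {A : ℝ} (hf : ∀ᵐ x ∂(volume.restrict Ω), |f x| ≤ A)
    {β : ℝ → ℝ} (hβ : Continuous β) : Integrable (fun x => β (f x)) (volume.restrict Ω) := by
  obtain ⟨B, -, -, hB⟩ := exists_bound_comp hf hβ
  exact Integrable.of_bound (hβ.comp_aestronglyMeasurable (Lp.memLp f).1) B hB

theorem memLp_comp {f : L2 Ω} {A : ℝ} (hf : ∀ᵐ x ∂(volume.restrict Ω), |f x| ≤ A)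
    {β : ℝ → ℝ} (hβ : Continuous β) : MemLp (fun x => β (f x)) 2 (volume.restrict Ω) := by
  obtain ⟨B, -, -, hB⟩ := exists_bound_comp hf hβ
  exact MemLp.of_bound (hβ.comp_aestronglyMeasurable (Lp.memLp f).1) B hB

/-- An `L^∞` bound passes to weak limits. -/
theorem ae_abs_le_of_weak_limit {w : ℕ → L2 Ω} {w₀ : L2 Ω} {A : ℝ}
    (hw : ∀ n, ∀ᵐ x ∂(volume.restrict Ω), |w n x| ≤ A)
    (h : ∀ ψ : L2 Ω, Tendsto (fun n => inner ℝ (w n) ψ) atTop (𝓝 (inner ℝ w₀ ψ))) :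
    ∀ᵐ x ∂(volume.restrict Ω), |w₀ x| ≤ A := by
  have hi : ∀ f : L2 Ω, Integrable f (volume.restrict Ω) := fun f =>
    (Lp.memLp f).integrable (by norm_num)
  have hlim : ∀ s, MeasurableSet s → Tendsto (fun n => ∫ x in s, w n x ∂(volume.restrict Ω)) atTop
      (𝓝 (∫ x in s, w₀ x ∂(volume.restrict Ω))) := by
    intro s hs
    have e : ∀ f : L2 Ω, ∫ x in s, f x ∂(volume.restrict Ω)
        = inner ℝ f (indicatorConstLp 2 hs (measure_ne_top _ s) (1 : ℝ)) := by
      intro f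
      rw [real_inner_comm, L2.inner_indicatorConstLp_one]
    simp only [e]
    exact h _
  have h1 : w₀ ≤ᵐ[volume.restrict Ω] fun _ => A :=
    ae_le_of_forall_setIntegral_le (hi w₀) (integrable_const A) fun s hs _ =>
      le_of_tendsto (hlim s hs) (Eventually.of_forall fun n =>
        integral_mono_ae (hi _).restrict (integrable_const A)
          (ae_restrict_of_ae ((hw n).mono fun x hx => (abs_le.1 hx).2)))
  have h2 : (fun _ => -A) ≤ᵐ[volume.restrict Ω] w₀ :=
    ae_le_of_forall_setIntegral_le (integrable_const _) (hi w₀) fun s hs _ =>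
      ge_of_tendsto (hlim s hs) (Eventually.of_forall fun n =>
        integral_mono_ae (integrable_const _) (hi _).restrict
          (ae_restrict_of_ae ((hw n).mono fun x hx => (abs_le.1 hx).1)))
  filter_upwards [h1, h2] with x a b
  exact abs_le.2 ⟨b, a⟩

/-- Convexity of `j`, in integrated form. -/
theorem integral_comp_sub_le_inner {j β : ℝ → ℝ} (hj : Continuous j)
    (hconv : ∀ a b, j b - j a ≤ β b * (b - a)) {f g ψ : L2 Ω} {A : ℝ}
    (hf : ∀ᵐ x ∂(volume.restrict Ω), |f x| ≤ A) (hg : ∀ᵐ x ∂(volume.restrict Ω), |g x| ≤ A)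
    (hψ : ψ =ᵐ[volume.restrict Ω] fun x => β (g x)) :
    (∫ x in Ω, j (g x)) - ∫ x in Ω, j (f x) ≤ inner ℝ (g - f) ψ := by
  rw [← integral_sub (integrable_comp hg hj) (integrable_comp hf hj), inner_eq_setIntegral]
  refine integral_mono_ae ((integrable_comp hg hj).sub (integrable_comp hf hj))
    (MemLp.integrable_mul (p := 2) (q := 2) (Lp.memLp _) (Lp.memLp _)) ?_
  filter_upwards [hψ, Lp.coeFn_sub g f] with x h1 h2
  simp only [h1, h2, Pi.sub_apply]
  rw [mul_comm]
  exact hconv _ _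

/-- Weak lower semicontinuity of a convex integral functional on bounded sequences. -/
theorem integral_comp_le_of_weak_limit {j β : ℝ → ℝ} (hj : Continuous j) (hβ : Continuous β)
    (hconv : ∀ a b, j b - j a ≤ β b * (b - a)) {w : ℕ → L2 Ω} {w₀ : L2 Ω} {A : ℝ}
    (hw : ∀ n, ∀ᵐ x ∂(volume.restrict Ω), |w n x| ≤ A)
    (h : ∀ ψ : L2 Ω, Tendsto (fun n => inner ℝ (w n) ψ) atTop (𝓝 (inner ℝ w₀ ψ)))
    {b : ℕ → ℝ} {b₀ : ℝ} (hb : Tendsto b atTop (𝓝 b₀)) (hle : ∀ n, ∫ x in Ω, j (w n x) ≤ b n) :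
    ∫ x in Ω, j (w₀ x) ≤ b₀ := by
  have hw₀ := ae_abs_le_of_weak_limit hw h
  have hm := memLp_comp hw₀ hβ
  have hlim : Tendsto (fun n => b n + inner ℝ (w₀ - w n) (hm.toLp _)) atTop (𝓝 b₀) := by
    simp only [inner_sub_left]
    have := hb.add ((h (hm.toLp _)).const_sub (inner ℝ w₀ (hm.toLp _)))
    simpa using this
  refine ge_of_tendsto' hlim fun n => ?_
  linarith [hle n, integral_comp_sub_le_inner hj hconv (hw n) hw₀ hm.coeFn_toLp]

/-- Integral functionals of a measurable, uniformly bounded family in `L²(Ω)` are measurable in the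
parameter. -/
theorem aestronglyMeasurable_integral_comp {j β : ℝ → ℝ} (hj : ∀ s, HasDerivAt j (β s) s)
    (hβ : Continuous β) (hj0 : j 0 = 0) {w : ℝ → L2 Ω} {ν : Measure ℝ}
    (hwm : AEStronglyMeasurable w ν) {A : ℝ} (hA : 0 ≤ A)
    (hw : ∀ᵐ t ∂ν, ∀ᵐ x ∂(volume.restrict Ω), |w t x| ≤ A) :
    AEStronglyMeasurable (fun t => ∫ x in Ω, j (w t x)) ν := by
  have hAA : -A ≤ A := by linarith
  obtain ⟨L, hL⟩ := (isCompact_Icc (a := -A) (b := A)).exists_bound_of_continuousOn hβ.continuousOn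
  -- truncation makes `j` Lipschitz without changing it on `[-A, A]`
  set jt : ℝ → ℝ := fun s => j (projIcc (-A) A hAA s) with hjt
  have hjL : LipschitzWith L.toNNReal jt := by
    refine LipschitzWith.of_dist_le_mul fun x y => ?_
    have h1 := (convex_Icc (-A) A).norm_image_sub_le_of_norm_hasDerivWithin_le (f := j)
      (C := (L.toNNReal : ℝ))
      (fun s _ => (hj s).hasDerivWithinAt)
      (fun s hs => (hL s hs).trans (Real.le_coe_toNNReal L))
      (projIcc (-A) A hAA y).2 (projIcc (-A) A hAA x).2
    rw [dist_eq_norm]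
    refine h1.trans (mul_le_mul_of_nonneg_left ?_ L.toNNReal.coe_nonneg)
    have := (LipschitzWith.projIcc hAA).dist_le_mul x y
    rw [Subtype.dist_eq, dist_eq_norm] at this
    simpa using this
  have hjt0 : jt 0 = 0 := by
    simp only [hjt]
    rw [projIcc_of_mem hAA (show (0 : ℝ) ∈ Icc (-A) A from ⟨by linarith, hA⟩)]
    exact hj0
  have hcont : Continuous fun f : L2 Ω =>
      inner ℝ (hjL.compLp hjt0 f) (indicatorConstLp 2 MeasurableSet.univ
        (measure_ne_top (volume.restrict Ω) univ) (1 : ℝ)) :=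
    (hjL.continuous_compLp hjt0).inner continuous_const
  refine (hcont.comp_aestronglyMeasurable hwm).congr ?_
  filter_upwards [hw] with t ht
  rw [real_inner_comm, L2.inner_indicatorConstLp_one, setIntegral_univ]
  refine integral_congr_ae ?_
  filter_upwards [hjL.coeFn_compLp hjt0 (w t), ht] with x h1 h2
  rw [h1, Function.comp_apply]
  simp only [hjt]
  rw [projIcc_of_mem hAA (abs_le.1 h2)]

end Bounded

/-! ### The transport equation at a fixed time -/

/-- The embedding of `L²(Ω)` into the dual of `H¹(Ω)` given by the `L²` inner product. -/
noncomputable def toH1Dual {Ω : Set (Space d)} (f : L2 Ω) : H1Dual Ω :=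
  (innerSL ℝ f).comp (H1.valL Ω)

theorem continuous_toH1Dual (Ω : Set (Space d)) : Continuous (toH1Dual (Ω := Ω)) :=
  (innerSL ℝ (E := L2 Ω)).continuous.clm_comp continuous_const

theorem norm_toH1Dual_le {Ω : Set (Space d)} (f : L2 Ω) : ‖toH1Dual f‖ ≤ ‖f‖ :=
  ContinuousLinearMap.opNorm_le_bound _ (norm_nonneg _) fun φ =>
    (abs_real_inner_le_norm _ _).trans
      (mul_le_mul_of_nonneg_left φ.norm_val_le (norm_nonneg _))

/-- Multiplication by a bounded function acts on `L²`. -/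
theorem exists_Lp_smul {α E : Type*} [MeasurableSpace α] {ν : Measure α} [NormedAddCommGroup E]
    [NormedSpace ℝ E] {a : α → ℝ} (ha : AEStronglyMeasurable a ν) {M : ℝ}
    (hM : ∀ᵐ x ∂ν, |a x| ≤ M) (v : Lp E 2 ν) :
    ∃ z : Lp E 2 ν, (z =ᵐ[ν] fun x => a x • v x) ∧ ‖z‖ ≤ M * ‖v‖ := by
  have hb : ∀ᵐ x ∂ν, ‖a x • v x‖ ≤ M * ‖v x‖ := hM.mono fun x hx => by
    rw [norm_smul]
    exact mul_le_mul_of_nonneg_right hx (norm_nonneg _)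
  have m : MemLp (fun x => a x • v x) 2 ν := (Lp.memLp v).of_le_mul (ha.smul (Lp.memLp v).1) hb
  refine ⟨m.toLp _, m.coeFn_toLp, Lp.norm_le_mul_norm_of_ae_le_mul ?_⟩
  filter_upwards [m.coeFn_toLp, hb] with x h1 h2
  rwa [h1]

/-- The tangent line inequality of a convex function. -/
theorem sub_le_of_deriv_monotone {j β : ℝ → ℝ} (hj : ∀ s, HasDerivAt j (β s) s)
    (hβ : Monotone β) (a b : ℝ) : j b - j a ≤ β b * (b - a) := by
  have hc : Continuous j := continuous_iff_continuousAt.2 fun s => (hj s).continuousAt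
  rcases lt_trichotomy a b with h | rfl | h
  · obtain ⟨ξ, hξ, e⟩ := exists_hasDerivAt_eq_slope j β h hc.continuousOn fun x _ => hj x
    have := hβ hξ.2.le
    rw [e, div_le_iff₀ (by linarith)] at this
    exact this
  · simp
  · obtain ⟨ξ, hξ, e⟩ := exists_hasDerivAt_eq_slope j β h hc.continuousOn fun x _ => hj x
    have := hβ hξ.1.le
    rw [e, le_div_iff₀ (by linarith)] at this
    linarith

/-- The bound for `∂c/∂t` in `(H¹(Ω))*` that the transport equation gives at a fixed time. -/
theorem norm_timeDeriv_le {Ω : Set (Space d)} (P : Params) {κ : Space d → ℝ}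
    (hκ : MemLp κ 2 (volume.restrict Ω)) {c : L2 Ω} {u : L2Vec Ω} {cH : H1 Ω} {c' : H1Dual Ω}
    {M : ℝ} (hM : ∀ᵐ x ∂(volume.restrict Ω), |c x| ≤ M)
    (htr : ∀ φ : H1 Ω, (1 + P.k) * c' φ - (∫ x in Ω, c x * inner ℝ (u x) (φ.grad x))
      + P.D * (∫ x in Ω, inner ℝ (cH.grad x) (φ.grad x))
      + ∫ x in Ω, κ x * c x * φ.val x = 0) :
    ‖c'‖ ≤ M * ‖u‖ + P.D * ‖cH‖ + M * ‖hκ.toLp κ‖ := by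
  obtain ⟨z, hz, hzn⟩ := exists_Lp_smul (Lp.memLp c).1 hM u
  obtain ⟨y, hy, hyn⟩ := exists_Lp_smul (Lp.memLp c).1 hM (hκ.toLp κ)
  have hnn : 0 ≤ M * ‖u‖ + P.D * ‖cH‖ + M * ‖hκ.toLp κ‖ := by
    have := norm_nonneg z
    have := norm_nonneg y
    have := mul_nonneg P.D_pos.le (norm_nonneg cH)
    linarith
  refine ContinuousLinearMap.opNorm_le_bound _ hnn fun φ => ?_
  have e1 : ∫ x in Ω, c x * inner ℝ (u x) (φ.grad x) = inner ℝ z φ.grad := by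
    rw [L2.inner_def]
    refine integral_congr_ae (hz.mono fun x hx => ?_)
    simp only [hx, real_inner_smul_left]
  have e2 : ∫ x in Ω, inner ℝ (cH.grad x) (φ.grad x) = inner ℝ cH.grad φ.grad := by
    rw [L2.inner_def]
  have e3 : ∫ x in Ω, κ x * c x * φ.val x = inner ℝ y φ.val := by
    rw [inner_eq_setIntegral]
    refine integral_congr_ae ?_
    filter_upwards [hy, hκ.coeFn_toLp] with x h1 h2
    rw [h1, h2, smul_eq_mul, mul_comm (c x)]
  have h := htr φ
  rw [e1, e2, e3] at h
  have b1 : |inner ℝ z φ.grad| ≤ M * ‖u‖ * ‖φ‖ :=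
    (abs_real_inner_le_norm _ _).trans (mul_le_mul hzn φ.norm_grad_le (norm_nonneg _)
      ((norm_nonneg _).trans hzn))
  have b2 : |P.D * inner ℝ cH.grad φ.grad| ≤ P.D * ‖cH‖ * ‖φ‖ := by
    rw [abs_mul, abs_of_pos P.D_pos, mul_assoc]
    exact mul_le_mul_of_nonneg_left ((abs_real_inner_le_norm _ _).trans
      (mul_le_mul cH.norm_grad_le φ.norm_grad_le (norm_nonneg _) (norm_nonneg _))) P.D_pos.le
  have b3 : |inner ℝ y φ.val| ≤ M * ‖hκ.toLp κ‖ * ‖φ‖ :=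
    (abs_real_inner_le_norm _ _).trans (mul_le_mul hyn φ.norm_val_le (norm_nonneg _)
      ((norm_nonneg _).trans hyn))
  have hk : |c' φ| ≤ |(1 + P.k) * c' φ| := by
    rw [abs_mul]
    refine le_mul_of_one_le_left (abs_nonneg _) ?_
    rw [abs_of_nonneg (by linarith [P.k_nonneg])]
    linarith [P.k_nonneg]
  rw [Real.norm_eq_abs]
  refine hk.trans ?_
  have e4 : (1 + P.k) * c' φ = inner ℝ z φ.grad - P.D * inner ℝ cH.grad φ.grad
      - inner ℝ y φ.val := by linarith
  rw [e4]
  rw [abs_le] at b1 b2 b3 ⊢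
  constructor <;> linarith [b1.1, b1.2, b2.1, b2.2, b3.1, b3.2]

/-- Dissipation at a fixed time. Testing the transport equation with `β(w)`, `w = a c`, for a
nondecreasing `β` with `β(0) = 0`: the diffusion term and the reaction term beyond `κ₁` have a
sign, and the convection term is `∫ u · ∇ B(w)` with `B'(s) = s β'(s)`, which vanishes as `u` is
solenoidal with zero normal trace. -/
theorem timeDeriv_comp_le {Ω : Set (Space d)} (ho : IsOpen Ω) (hfin : volume Ω ≠ ∞) (P : Params)
    {κ : Space d → ℝ} (hκ : MemLp κ 2 (volume.restrict Ω)) {κ₁ : ℝ}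
    (hκ_ge : ∀ᵐ x ∂(volume.restrict Ω), κ₁ ≤ κ x) {c : L2 Ω} {u : L2Vec Ω} {cH : H1 Ω}
    {c' : H1Dual Ω} (hcH : cH.val = c) (hu : u ∈ HSol Ω)
    {M : ℝ} (hM : ∀ᵐ x ∂(volume.restrict Ω), |c x| ≤ M)
    (htr : ∀ φ : H1 Ω, (1 + P.k) * c' φ - (∫ x in Ω, c x * inner ℝ (u x) (φ.grad x))
      + P.D * (∫ x in Ω, inner ℝ (cH.grad x) (φ.grad x))
      + ∫ x in Ω, κ x * c x * φ.val x = 0)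
    {β β' : ℝ → ℝ} (hβ : ∀ s, HasDerivAt β (β' s) s) (hβ' : Continuous β') (hpos : ∀ s, 0 ≤ β' s)
    (hβ0 : β 0 = 0) {a : ℝ} (ha : 0 < a) {ψ : H1 Ω}
    (hψv : ψ.val =ᵐ[volume.restrict Ω] fun x => β ((a • cH).val x))
    (hψg : ψ.grad =ᵐ[volume.restrict Ω] fun x => β' ((a • cH).val x) • (a • cH).grad x) :
    (1 + P.k) * c' ψ + κ₁ * inner ℝ c ψ.val ≤ 0 := by
  have hmono : Monotone β := monotone_of_deriv_nonneg (fun s => (hβ s).differentiableAt)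
    (fun s => by rw [(hβ s).deriv]; exact hpos s)
  have hsβ : ∀ s, 0 ≤ s * β s := fun s => by
    rcases le_total 0 s with h | h
    · exact mul_nonneg h (hβ0 ▸ hmono h)
    · exact mul_nonneg_of_nonpos_of_nonpos h (hβ0 ▸ hmono h)
  have hval : (a • cH).val =ᵐ[volume.restrict Ω] fun x => a * c x := by
    rw [H1.val_smul, hcH]
    exact Lp.coeFn_smul a c
  have hgrad : (a • cH).grad =ᵐ[volume.restrict Ω] fun x => a • cH.grad x := by
    rw [H1.grad_smul]
    exact Lp.coeFn_smul a cH.grad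
  have hw : ∀ᵐ x ∂(volume.restrict Ω), |(a • cH).val x| ≤ a * M := by
    filter_upwards [hval, hM] with x h1 h2
    rw [h1, abs_mul, abs_of_pos ha]
    exact mul_le_mul_of_nonneg_left h2 ha.le
  -- the convection term
  have hconv : ∫ x in Ω, c x * inner ℝ (u x) (ψ.grad x) = 0 := by
    have hc : Continuous fun r => r * β' r := continuous_id.mul hβ'
    obtain ⟨χ, -, hχ⟩ := H1.exists_comp ho hfin (a • cH) hw
      (β := fun s => ∫ r in (0)..s, r * β' r) (β' := fun r => r * β' r)
      (fun s => (hc.integral_hasStrictDerivAt 0 s).hasDerivAt) hc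
    have h0 := hu.2 χ
    have hz : ∫ x in Ω, (0 : L2 Ω) x * χ.val x = 0 := by
      rw [← inner_eq_setIntegral, inner_zero_left]
    rw [hz, add_zero] at h0
    have e : ∫ x in Ω, inner ℝ (u x) (χ.grad x)
        = a * ∫ x in Ω, c x * inner ℝ (u x) (ψ.grad x) := by
      rw [← integral_const_mul]
      refine integral_congr_ae ?_
      filter_upwards [hχ, hψg, hval] with x h1 h2 h3
      rw [h1, h2, h3, real_inner_smul_right, real_inner_smul_right]
      ring
    rw [h0] at e
    exact (mul_eq_zero.1 e.symm).resolve_left ha.ne'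
  -- the diffusion term
  have hdiff : 0 ≤ ∫ x in Ω, inner ℝ (cH.grad x) (ψ.grad x) := by
    refine integral_nonneg_of_ae ?_
    filter_upwards [hψg, hgrad] with x h1 h2
    rw [h1, h2, real_inner_smul_right, real_inner_smul_right, Pi.zero_apply]
    exact mul_nonneg (hpos _) (mul_nonneg ha.le real_inner_self_nonneg)
  -- the reaction term
  have hreac : κ₁ * inner ℝ c ψ.val ≤ ∫ x in Ω, κ x * c x * ψ.val x := by
    rw [inner_eq_setIntegral, ← integral_const_mul]
    obtain ⟨y, hy, -⟩ := exists_Lp_smul (Lp.memLp c).1 hM (hκ.toLp κ)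
    have i1 : Integrable (fun x => κ x * c x * ψ.val x) (volume.restrict Ω) := by
      refine (MemLp.integrable_mul (p := 2) (q := 2) (Lp.memLp y) (Lp.memLp ψ.val)).congr ?_
      filter_upwards [hy, hκ.coeFn_toLp] with x h1 h2
      rw [Pi.mul_apply, h1, h2, smul_eq_mul, mul_comm (c x)]
    refine integral_mono_ae
      ((MemLp.integrable_mul (p := 2) (q := 2) (Lp.memLp c) (Lp.memLp ψ.val)).const_mul κ₁) i1 ?_
    filter_upwards [hψv, hval, hκ_ge] with x h1 h2 h3
    have h4 : 0 ≤ c x * ψ.val x := by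
      have h5 := hsβ (a * c x)
      rw [h1, h2]
      rw [mul_assoc] at h5
      exact nonneg_of_mul_nonneg_right h5 ha
    simp only [mul_assoc]
    exact mul_le_mul_of_nonneg_right h3 h4
  have h := htr ψ
  rw [hconv] at h
  nlinarith [mul_nonneg P.D_pos.le hdiff]

/-! ### Convex functionals of the weighted concentration -/

theorem exists_memLp_extension {E : Type*} [NormedAddCommGroup E] {s : Set ℝ}
    (hs : MeasurableSet s) {f : ℝ → E} (hf : MemLp f 2 (volume.restrict s)) :
    ∃ k : ℝ → E, MemLp k 2 volume ∧ (∀ t ∈ s, k t = f t) ∧ ∀ t, t ∉ s → k t = 0 :=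
  ⟨s.indicator f, (memLp_indicator_iff_restrict hs).2 hf, fun _ ht => indicator_of_mem ht f,
    fun _ ht => indicator_of_notMem ht f⟩

/-- The integral of `w' · ψ` over the last time step `(t - h, t)` is controlled by the oscillation
of `w'` alone if `w' t ψ ≤ 0`. Here `k` is the extension of `w'` by zero outside `(0, T)`. -/
theorem ofReal_integral_apply_le {X : Type*} [NormedAddCommGroup X] [NormedSpace ℝ X]
    {w' k : ℝ → StrongDual ℝ X} {T : ℝ} (hkm : MemLp k 2 volume)
    (hk : ∀ t ∈ Ioo 0 T, k t = w' t) (hk0 : ∀ t, t ∉ Ioo 0 T → k t = 0) {t h : ℝ}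
    (ht : t ∈ Ioo 0 T) (hh : 0 < h) {ψ : X} {b : ℝ} (hψ : ‖ψ‖ ≤ b) (hle : w' t ψ ≤ 0) :
    ENNReal.ofReal (∫ τ in (max (t - h) 0)..t, w' τ ψ)
      ≤ ‖b‖ₑ * ∫⁻ r in Ioc 0 h, ‖k (t - r) - k t‖ₑ := by
  have hmax : max (t - h) 0 ≤ t := max_le (by linarith) ht.1.le
  have hkψ : ∀ a b, IntervalIntegrable (fun τ => k τ ψ) volume a b := by
    intro a b
    have hloc : LocallyIntegrable k volume := hkm.locallyIntegrable (by norm_num)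
    have h8 : IntervalIntegrable k volume a b :=
      (hloc.integrableOn_isCompact isCompact_uIcc).intervalIntegrable
    exact ⟨h8.1.apply_continuousLinearMap ψ, h8.2.apply_continuousLinearMap ψ⟩
  have h7 : ∫ τ in (max (t - h) 0)..t, w' τ ψ = ∫ r in (0)..h, k (t - r) ψ := by
    rw [intervalIntegral.integral_comp_sub_left (fun τ => k τ ψ) t, sub_zero,
      ← intervalIntegral.integral_add_adjacent_intervals (hkψ (t - h) (max (t - h) 0))
        (hkψ (max (t - h) 0) t)]
    have z1 : ∫ τ in (t - h)..(max (t - h) 0), k τ ψ = 0 := by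
      rcases le_or_gt (t - h) 0 with h0 | h0
      · rw [max_eq_right h0]
        refine intervalIntegral.integral_zero_ae (Eventually.of_forall fun τ hτ => ?_)
        rw [uIoc_of_le h0] at hτ
        rw [hk0 τ (fun hc => absurd hc.1 (not_lt.2 hτ.2))]
        rfl
      · rw [max_eq_left h0.le, intervalIntegral.integral_same]
    rw [z1, zero_add]
    refine intervalIntegral.integral_congr_ae (Eventually.of_forall fun τ hτ => ?_)
    rw [uIoc_of_le hmax] at hτ
    rw [hk τ ⟨(le_max_right _ _).trans_lt hτ.1, hτ.2.trans_lt ht.2⟩]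
  have hkψ' : IntervalIntegrable (fun r => k (t - r) ψ) volume 0 h := by
    simpa using (hkψ t (t - h)).comp_sub_left t
  have h8 : ∫ τ in (max (t - h) 0)..t, w' τ ψ ≤ ∫ r in (0)..h, (k (t - r) - k t) ψ := by
    have e : ∫ r in (0)..h, (k (t - r) - k t) ψ = (∫ r in (0)..h, k (t - r) ψ) - h * k t ψ := by
      simp only [_root_.sub_apply]
      rw [intervalIntegral.integral_sub hkψ' (by simp)]
      simp
    have hkt : k t ψ ≤ 0 := by rw [hk t ht]; exact hle
    rw [e, h7]
    linarith [mul_nonpos_of_nonneg_of_nonpos hh.le hkt]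
  calc ENNReal.ofReal (∫ τ in (max (t - h) 0)..t, w' τ ψ)
      ≤ ENNReal.ofReal (∫ r in (0)..h, (k (t - r) - k t) ψ) := ENNReal.ofReal_le_ofReal h8
    _ ≤ ‖∫ r in Ioc 0 h, (k (t - r) - k t) ψ‖ₑ := by
        rw [intervalIntegral.integral_of_le hh.le, ← ofReal_norm]
        exact ENNReal.ofReal_le_ofReal (Real.le_norm_self _)
    _ ≤ ∫⁻ r in Ioc 0 h, ‖(k (t - r) - k t) ψ‖ₑ := enorm_integral_le_lintegral_enorm _
    _ ≤ ∫⁻ r in Ioc 0 h, ‖b‖ₑ * ‖k (t - r) - k t‖ₑ := by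
        refine lintegral_mono fun r => ?_
        rw [← ofReal_norm, ← ofReal_norm, ← ofReal_norm, ← ENNReal.ofReal_mul (norm_nonneg _),
          mul_comm]
        exact ENNReal.ofReal_le_ofReal ((ContinuousLinearMap.le_opNorm _ _).trans
          (mul_le_mul_of_nonneg_left (hψ.trans (Real.le_norm_self _)) (norm_nonneg _)))
    _ = _ := lintegral_const_mul' _ _ enorm_ne_top

namespace IsWeakSolutionWith

variable {Ω : Set (Space d)} {P : Params} {g : Space d → Space d} {κ c₀ : Space d → ℝ}
  {c : ℝ → L2 Ω} {u : ℝ → L2Vec Ω} {cH : ℝ → H1 Ω} {c' : ℝ → H1Dual Ω}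

theorem exists_ae_bound (hs : IsWeakSolutionWith Ω P g κ c₀ c u cH c') :
    ∃ M : ℝ, 0 ≤ M ∧ ∀ᵐ t ∂(volume.restrict (Ioi (0 : ℝ))),
      ∀ᵐ x ∂(volume.restrict Ω), |c t x| ≤ M := by
  obtain ⟨M, hM⟩ := hs.bounded
  refine ⟨max M 0, le_max_right _ _, hM.mono fun t ht => ?_⟩
  rw [eLpNorm_exponent_top] at ht
  filter_upwards [ae_le_eLpNormEssSup (f := c t) (μ := volume.restrict Ω)] with x hx
  have h := hx.trans (ht.trans (ENNReal.ofReal_le_ofReal (le_max_left M 0)))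
  rwa [← ofReal_norm, ENNReal.ofReal_le_ofReal_iff (le_max_right _ _)] at h

theorem aestronglyMeasurable (hs : IsWeakSolutionWith Ω P g κ c₀ c u cH c') :
    AEStronglyMeasurable c (volume.restrict (Ioi (0 : ℝ))) :=
  ((H1.valL Ω).continuous.comp_aestronglyMeasurable hs.memLp_H1.1).congr hs.val_eq

theorem aestronglyMeasurable_timeDeriv (hs : IsWeakSolutionWith Ω P g κ c₀ c u cH c') {T : ℝ}
    (hT : 0 < T) : AEStronglyMeasurable c' (volume.restrict (Ioo 0 T)) :=
  (hs.memLp_timeDeriv T hT).1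

theorem integrableOn_timeDeriv (hs : IsWeakSolutionWith Ω P g κ c₀ c u cH c') {T : ℝ}
    (hT : 0 < T) (φ : H1 Ω) : IntegrableOn (fun t => c' t φ) (Ioo 0 T) := by
  have h1 : (1 : ℝ≥0∞) ≤ timeExponent d := by
    rw [timeExponent]
    split_ifs
    · norm_num
    · rw [ENNReal.le_div_iff_mul_le (by simp) (by simp)]
      norm_num
  have := (hs.memLp_timeDeriv T hT).integrable h1
  exact this.apply_continuousLinearMap φ

/-- The weak time derivative of the weighted concentration `e^{at} c`, in integrated form. -/
theorem inner_sub_eq_integral (hs : IsWeakSolutionWith Ω P g κ c₀ c u cH c') (a : ℝ) (φ : H1 Ω)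
    {s t : ℝ} (h0 : 0 ≤ s) (hst : s ≤ t) :
    inner ℝ (Real.exp (a * t) • c t - Real.exp (a * s) • c s) φ.val
      = ∫ τ in s..t, (Real.exp (a * τ) • (c' τ + a • toH1Dual (c τ))) φ := by
  have h1 : WeakDeriv (fun t => inner ℝ (c t) φ.val) (fun t => c' t φ) :=
    fun ψ h1 h2 h3 => hs.timeDeriv ψ h1 h2 h3 φ
  have hci := fun T hT => hs.integrableOn_timeDeriv (T := T) hT φ
  have h2 := h1.exp_mul (hs.continuous φ) hci a
  have hexp : Continuous fun t => Real.exp (a * t) := by fun_prop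
  have h3 := h2.sub_eq_integral (hexp.continuousOn.mul (hs.continuous φ)) (fun T hT => by
    have hsum : IntegrableOn (fun t => c' t φ + a * inner ℝ (c t) φ.val) (Ioo 0 T) :=
      (hci T hT).add (((((hs.continuous φ).mono fun x hx => hx.1 :
        ContinuousOn _ (Icc 0 T)).integrableOn_Icc).mono_set Ioo_subset_Icc_self).const_mul a)
    have hb : ∀ᵐ t ∂(volume.restrict (Ioo 0 T)), ‖Real.exp (a * t)‖ ≤ Real.exp (|a| * T) := by
      filter_upwards [ae_restrict_mem measurableSet_Ioo] with t ht
      rw [Real.norm_eq_abs, Real.abs_exp, Real.exp_le_exp]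
      exact mul_le_mul (le_abs_self a) ht.2.le ht.1.le (abs_nonneg a)
    exact hsum.bdd_mul (c := Real.exp (|a| * T)) hexp.aestronglyMeasurable hb) h0 hst
  rw [inner_sub_left, real_inner_smul_left, real_inner_smul_left, h3]
  rfl

/-- The derivative of the weighted concentration is square-integrable in time. -/
theorem memLp_weighted_timeDeriv (hs : IsWeakSolutionWith Ω P g κ c₀ c u cH c')
    (hκ : MemLp κ 2 (volume.restrict Ω)) {a : ℝ} (ha : 0 ≤ a) {T : ℝ} (hT : 0 < T) :
    MemLp (fun t => Real.exp (a * t) • (c' t + a • toH1Dual (c t))) 2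
      (volume.restrict (Ioo 0 T)) := by
  obtain ⟨M, hM0, hM⟩ := hs.exists_ae_bound
  have hsub : volume.restrict (Ioo 0 T) ≤ volume.restrict (Ioi (0 : ℝ)) :=
    Measure.restrict_mono Ioo_subset_Ioi_self le_rfl
  have hac := hsub.absolutelyContinuous
  have hu : MemLp (fun t => ‖u t‖) 2 (volume.restrict (Ioo 0 T)) :=
    (hs.memLp_u.mono_measure hsub).norm
  have hc : MemLp (fun t => ‖cH t‖) 2 (volume.restrict (Ioo 0 T)) :=
    (hs.memLp_H1.mono_measure hsub).norm
  have hG : MemLp (fun t => Real.exp (a * T) *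
      (M * ‖u t‖ + P.D * ‖cH t‖ + M * ‖hκ.toLp κ‖ + a * ‖cH t‖)) 2 (volume.restrict (Ioo 0 T)) :=
    ((((hu.const_mul M).add (hc.const_mul P.D)).add (memLp_const _)).add
      (hc.const_mul a)).const_mul _
  refine hG.mono ?_ ?_
  · have hexp : Continuous fun t => Real.exp (a * t) := by fun_prop
    exact hexp.aestronglyMeasurable.smul ((hs.aestronglyMeasurable_timeDeriv hT).add
      (((continuous_toH1Dual Ω).comp_aestronglyMeasurable
        (hs.aestronglyMeasurable.mono_measure hsub)).const_smul a))
  · filter_upwards [hac.ae_le hM, hac.ae_le hs.transport, hac.ae_le hs.val_eq,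
      ae_restrict_mem measurableSet_Ioo] with t h1 h2 h3 h4
    have b1 := norm_timeDeriv_le P hκ h1 h2
    have b2 : ‖toH1Dual (c t)‖ ≤ ‖cH t‖ := by
      rw [← h3]
      exact (norm_toH1Dual_le _).trans (cH t).norm_val_le
    rw [norm_smul, Real.norm_eq_abs, Real.abs_exp]
    refine (mul_le_mul (Real.exp_le_exp.2 (mul_le_mul_of_nonneg_left h4.2.le ha))
      ((norm_add_le _ _).trans (add_le_add b1 ?_)) (norm_nonneg _) (Real.exp_pos _).le).trans
      (Real.le_norm_self _)
    rw [norm_smul, Real.norm_eq_abs, abs_of_nonneg ha]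
    exact mul_le_mul_of_nonneg_left b2 ha

/-- Every convex integral functional of the weighted concentration `e^{λt} c(t)`,
`λ = κ₁ / (1 + k)`, is bounded by its initial value. -/
theorem integral_convex_le (hs : IsWeakSolutionWith Ω P g κ c₀ c u cH c') (ho : IsOpen Ω)
    (hfin : volume Ω ≠ ∞) (hκ : MemLp κ 2 (volume.restrict Ω)) {κ₁ : ℝ} (hκ₁ : 0 < κ₁)
    (hκ_ge : ∀ᵐ x ∂(volume.restrict Ω), κ₁ ≤ κ x) {M₂ : ℝ}
    (hc₀ : ∀ᵐ x ∂(volume.restrict Ω), |c₀ x| ≤ M₂) {lam : ℝ} (hlam : lam = κ₁ / (1 + P.k))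
    {T : ℝ} (hT : 0 < T) :
    ∃ A, (∀ᵐ x ∂(volume.restrict Ω), |(Real.exp (lam * T) • c T) x| ≤ A) ∧
      ∀ j β β' : ℝ → ℝ, (∀ s, HasDerivAt j (β s) s) → (∀ s, HasDerivAt β (β' s) s) →
        Continuous β' → (∀ s, 0 ≤ β' s) → j 0 = 0 → β 0 = 0 →
        ∫ x in Ω, j ((Real.exp (lam * T) • c T) x) ≤ ∫ x in Ω, j (c₀ x) := by
  have : IsFiniteMeasure (volume.restrict Ω) := ⟨by simpa using hfin.lt_top⟩
  have hk1 : 0 < 1 + P.k := by linarith [P.k_nonneg]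
  have hlam0 : 0 ≤ lam := by rw [hlam]; positivity
  obtain ⟨M, hM0, hM⟩ := hs.exists_ae_bound
  have hsub : volume.restrict (Ioo 0 T) ≤ volume.restrict (Ioi (0 : ℝ)) :=
    Measure.restrict_mono Ioo_subset_Ioi_self le_rfl
  have hac := hsub.absolutelyContinuous
  set w : ℝ → L2 Ω := fun t => Real.exp (lam * t) • c t with hw
  set w' : ℝ → H1Dual Ω := fun t => Real.exp (lam * t) • (c' t + lam • toH1Dual (c t)) with hw'
  set A : ℝ := max (Real.exp (lam * T) * M) M₂ with hA
  have hA0 : 0 ≤ A := le_trans (by positivity) (le_max_left _ _)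
  have hw0 : w 0 = c 0 := by simp [hw]
  have hw0c : w 0 =ᵐ[volume.restrict Ω] c₀ := by rw [hw0]; exact hs.initial
  have hwA0 : ∀ᵐ x ∂(volume.restrict Ω), |w 0 x| ≤ A := by
    filter_upwards [hw0c, hc₀] with x h1 h2
    rw [h1]
    exact h2.trans (le_max_right _ _)
  have hwA : ∀ᵐ t ∂(volume.restrict (Ioo 0 T)), ∀ᵐ x ∂(volume.restrict Ω), |w t x| ≤ A := by
    filter_upwards [hac.ae_le hM, ae_restrict_mem measurableSet_Ioo] with t h1 h2
    filter_upwards [h1, Lp.coeFn_smul (Real.exp (lam * t)) (c t)] with x h3 h4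
    simp only [hw]
    rw [h4, Pi.smul_apply, smul_eq_mul, abs_mul, Real.abs_exp]
    refine (mul_le_mul (Real.exp_le_exp.2 (mul_le_mul_of_nonneg_left h2.2.le hlam0)) h3
      (abs_nonneg _) (Real.exp_pos _).le).trans (le_max_left _ _)
  have hexp : Continuous fun t => Real.exp (lam * t) := by fun_prop
  have hwm : AEStronglyMeasurable w (volume.restrict (Ioo 0 T)) :=
    hexp.aestronglyMeasurable.smul (hs.aestronglyMeasurable.mono_measure hsub)
  have hw'2 := hs.memLp_weighted_timeDeriv hκ hlam0 hT
  -- values at times close to `T` control the value at `T` by weak convergence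
  have hweak : ∀ t : ℕ → ℝ, (∀ n, t n ∈ Ioo 0 T) → Tendsto t atTop (𝓝 T) →
      (∀ n, ∀ᵐ x ∂(volume.restrict Ω), |w (t n) x| ≤ A) →
      ∀ ψ : L2 Ω, Tendsto (fun n => inner ℝ (w (t n)) ψ) atTop (𝓝 (inner ℝ (w T) ψ)) := by
    intro t ht htT htA ψ
    refine tendsto_inner_of_dense (H1.denseRange_valL ho) (fun n => norm_L2_le (htA n) hA0) ?_ ψ
    rintro _ ⟨φ, rfl⟩
    have hcont : ContinuousOn (fun t => inner ℝ (w t) φ.val) (Ici (0 : ℝ)) := by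
      simp only [hw, real_inner_smul_left]
      exact hexp.continuousOn.mul (hs.continuous φ)
    exact (hcont T hT.le).tendsto.comp (tendsto_nhdsWithin_iff.2
      ⟨htT, Eventually.of_forall fun n => (ht n).1.le⟩)
  refine ⟨A, ?_, ?_⟩
  · -- choose good times converging to `T`
    have hex : ∀ n : ℕ, ∃ t ∈ Ioo 0 T, T - 1 / ((n : ℝ) + 1) < t ∧
        ∀ᵐ x ∂(volume.restrict Ω), |w t x| ≤ A := by
      intro n
      have hlt : max (T - 1 / ((n : ℝ) + 1)) 0 < T :=
        max_lt (sub_lt_self T Nat.one_div_pos_of_nat) hT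
      have : NeBot (ae (volume.restrict (Ioo (max (T - 1 / ((n : ℝ) + 1)) 0) T))) :=
        ae_restrict_neBot.2 (by simpa using hlt)
      obtain ⟨t, h1, h2⟩ := ((ae_restrict_mem (s := Ioo (max (T - 1 / ((n : ℝ) + 1)) 0) T)
        measurableSet_Ioo).and (ae_restrict_of_ae_restrict_of_subset
          (Ioo_subset_Ioo_left (le_max_right _ _)) hwA)).exists
      exact ⟨t, ⟨(le_max_right _ _).trans_lt h1.1, h1.2⟩, (le_max_left _ _).trans_lt h1.1, h2⟩
    choose t h1 h2 h3 using hex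
    refine ae_abs_le_of_weak_limit h3 (hweak t h1 ?_ h3)
    refine tendsto_of_tendsto_of_tendsto_of_le_of_le (g := fun n : ℕ => T - 1 / ((n : ℝ) + 1)) ?_
      tendsto_const_nhds (fun n => (h2 n).le) (fun n => (h1 n).2.le)
    simpa using tendsto_const_nhds.sub (tendsto_one_div_add_atTop_nhds_zero_nat (𝕜 := ℝ))
  intro j β β' hj hβ hβ' hpos hj0 hβ0
  have hjc : Continuous j := continuous_iff_continuousAt.2 fun s => (hj s).continuousAt
  have hβc : Continuous β := continuous_iff_continuousAt.2 fun s => (hβ s).continuousAt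
  have hmono : Monotone β := monotone_of_deriv_nonneg (fun s => (hβ s).differentiableAt)
    (fun s => by rw [(hβ s).deriv]; exact hpos s)
  have hconv := sub_le_of_deriv_monotone hj hmono
  obtain ⟨B₁, hB₁0, hB₁, -⟩ := exists_bound_comp hwA0 hβc
  obtain ⟨B₂, hB₂0, hB₂, -⟩ := exists_bound_comp hwA0 hβ'
  obtain ⟨B₃, hB₃0, hB₃, -⟩ := exists_bound_comp hwA0 hjc
  set m : ℝ := (measureUnivNNReal (volume.restrict Ω) : ℝ) ^ (2 : ℝ)⁻¹ with hm
  -- the test functions `β(w)` and their norms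
  set B : ℝ → ℝ := fun t => m * B₁ + B₂ * Real.exp (lam * T) * ‖cH t‖ with hB
  have htest : ∀ᵐ t ∂(volume.restrict (Ioo 0 T)), ∃ ψ : H1 Ω,
      (ψ.val =ᵐ[volume.restrict Ω] fun x => β (w t x)) ∧ ‖ψ‖ ≤ B t ∧ w' t ψ ≤ 0 := by
    filter_upwards [hac.ae_le hM, hac.ae_le hs.transport, hac.ae_le hs.val_eq,
      hac.ae_le hs.u_mem, hwA, ae_restrict_mem measurableSet_Ioo] with t h1 h2 h3 h4 h5 h6
    have hwt : (Real.exp (lam * t) • cH t).val = w t := by rw [H1.val_smul, h3]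
    obtain ⟨ψ, hψv, hψg⟩ := H1.exists_comp ho hfin (Real.exp (lam * t) • cH t) (A := A)
      (by rw [hwt]; exact h5) hβ hβ'
    refine ⟨ψ, by rwa [hwt] at hψv, ?_, ?_⟩
    · refine ψ.norm_le.trans (add_le_add (norm_L2_le ?_ hB₁0) ?_)
      · rw [hwt] at hψv
        filter_upwards [hψv, h5] with x h7 h8
        rw [h7]
        exact hB₁ _ h8
      · have h7 : ‖ψ.grad‖ ≤ B₂ * ‖(Real.exp (lam * t) • cH t).grad‖ := by
          refine Lp.norm_le_mul_norm_of_ae_le_mul ?_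
          rw [hwt] at hψg
          filter_upwards [hψg, h5] with x h8 h9
          rw [h8, norm_smul]
          exact mul_le_mul_of_nonneg_right (hB₂ _ h9) (norm_nonneg _)
        rw [H1.grad_smul, norm_smul, Real.norm_eq_abs, Real.abs_exp] at h7
        refine h7.trans ?_
        rw [mul_assoc]
        refine mul_le_mul_of_nonneg_left (mul_le_mul (Real.exp_le_exp.2
          (mul_le_mul_of_nonneg_left h6.2.le hlam0)) (cH t).norm_grad_le (norm_nonneg _)
          (Real.exp_pos _).le) hB₂0
    · have h7 := timeDeriv_comp_le ho hfin P hκ hκ_ge h3 h4 h1 h2 hβ hβ' hpos hβ0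
        (Real.exp_pos (lam * t)) hψv hψg
      have h8 : w' t ψ = Real.exp (lam * t) * (c' t ψ + lam * inner ℝ (c t) ψ.val) := rfl
      rw [h8]
      refine mul_nonpos_of_nonneg_of_nonpos (Real.exp_pos _).le ?_
      have h9 : κ₁ = (1 + P.k) * lam := by rw [hlam]; field_simp
      rw [h9, mul_assoc, ← mul_add] at h7
      exact nonpos_of_mul_nonpos_right h7 hk1
  have hcm : MemLp (fun t => ‖cH t‖) 2 (volume.restrict (Ioo 0 T)) :=
    (hs.memLp_H1.mono_measure hsub).norm
  have hBm : MemLp B 2 (volume.restrict (Ioo 0 T)) := by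
    have h1 : MemLp (fun _ : ℝ => m * B₁) 2 (volume.restrict (Ioo 0 T)) := memLp_const _
    exact h1.add (hcm.const_mul (B₂ * Real.exp (lam * T)))
  obtain ⟨k, hkm, hk, hk0⟩ := exists_memLp_extension measurableSet_Ioo hw'2
  set J : ℝ → ℝ := fun t => ∫ x in Ω, j (w t x) with hJ
  have hJm : AEStronglyMeasurable J (volume.restrict (Ioo 0 T)) :=
    aestronglyMeasurable_integral_comp hj hβc hj0 hwm hA0 hwA
  have hJb : ∀ᵐ t ∂(volume.restrict (Ioo 0 T)), |J t| ≤ B₃ * (volume.restrict Ω).real univ := by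
    filter_upwards [hwA] with t ht
    exact norm_integral_le_of_norm_le_const (f := fun x => j (w t x)) (C := B₃)
      (ht.mono fun x hx => hB₃ _ hx)
  have hinc : ∀ h, 0 < h → ∀ᵐ t ∂(volume.restrict (Ioo 0 T)),
      ENNReal.ofReal (J t - J (max (t - h) 0)) ≤ ‖B t‖ₑ * ∫⁻ r in Ioc 0 h, ‖k (t - r) - k t‖ₑ := by
    intro h hh
    -- for almost every `t`, the earlier time `t - h` is also one where `w` is bounded by `A`
    have hshift : ∀ᵐ t : ℝ, t - h ∈ Ioo 0 T → ∀ᵐ x ∂(volume.restrict Ω), |w (t - h) x| ≤ A :=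
      (measurePreserving_sub_right volume h).quasiMeasurePreserving.ae
        ((ae_restrict_iff' measurableSet_Ioo).1 hwA)
    filter_upwards [htest, hwA, ae_restrict_of_ae hshift, ae_restrict_mem measurableSet_Ioo]
      with t h1 h2 h3 ht
    obtain ⟨ψ, hψv, hψn, hψle⟩ := h1
    have h4 : ∀ᵐ x ∂(volume.restrict Ω), |w (max (t - h) 0) x| ≤ A := by
      rcases le_or_gt (t - h) 0 with h0 | h0
      · rw [max_eq_right h0]; exact hwA0
      · rw [max_eq_left h0.le]; exact h3 ⟨h0, by linarith [ht.2]⟩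
    have h5 := integral_comp_sub_le_inner hjc hconv h4 h2 hψv
    have hmax : max (t - h) 0 ≤ t := max_le (by linarith) ht.1.le
    have h6 := hs.inner_sub_eq_integral lam ψ (le_max_right (t - h) 0) hmax
    refine le_trans (ENNReal.ofReal_le_ofReal ?_)
      (ofReal_integral_apply_le hkm hk hk0 ht hh hψn hψle)
    exact h5.trans h6.le
  have hex : ∀ n : ℕ, ∃ t ∈ Ioo 0 T, T - 1 / ((n : ℝ) + 1) < t ∧
      (∀ᵐ x ∂(volume.restrict Ω), |w t x| ≤ A) ∧ J t ≤ J 0 + 1 / ((n : ℝ) + 1) := fun n =>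
    exists_le_of_increment_le hkm hT hBm hJm hJb hinc hwA
      Nat.one_div_pos_of_nat Nat.one_div_pos_of_nat
  choose t h1 h2 h3 h4 using hex
  have hlim : Tendsto t atTop (𝓝 T) := by
    refine tendsto_of_tendsto_of_tendsto_of_le_of_le (g := fun n : ℕ => T - 1 / ((n : ℝ) + 1)) ?_
      tendsto_const_nhds (fun n => (h2 n).le) (fun n => (h1 n).2.le)
    simpa using tendsto_const_nhds.sub (tendsto_one_div_add_atTop_nhds_zero_nat (𝕜 := ℝ))
  have hfinal := integral_comp_le_of_weak_limit hjc hβc hconv h3 (hweak t h1 hlim h3)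
    (b := fun n => J 0 + 1 / ((n : ℝ) + 1)) (b₀ := J 0)
    (by simpa using (tendsto_one_div_add_atTop_nhds_zero_nat (𝕜 := ℝ)).const_add (J 0)) h4
  refine hfinal.trans (le_of_eq (integral_congr_ae (hw0c.mono fun x hx => ?_)))
  simp only [hx]

end IsWeakSolutionWith

/-! ### From convex functionals to `L^p` norms -/

/-- On a finite measure space the `L^∞` norm is controlled by the `L^p` norms with `p < ∞`. -/
theorem eLpNorm_top_le_of_forall_eLpNorm_le {α : Type*} [MeasurableSpace α] {ν : Measure α}
    [IsFiniteMeasure ν] {f g : α → ℝ} (hf : AEStronglyMeasurable f ν)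
    (hg : AEStronglyMeasurable g ν)
    (h : ∀ p : ℝ≥0∞, 1 ≤ p → p ≠ ∞ → eLpNorm f p ν ≤ eLpNorm g p ν) :
    eLpNorm f ∞ ν ≤ eLpNorm g ∞ ν := by
  refine le_of_forall_gt fun b hb => ?_
  obtain ⟨a, hga, hab⟩ := exists_between hb
  refine lt_of_le_of_lt ?_ hab
  have ha0 : a ≠ 0 := (bot_le.trans_lt hga).ne'
  have hat : a ≠ ∞ := (hab.trans_le le_top).ne
  have hx : a⁻¹ * eLpNorm g ∞ ν < 1 := by
    rw [mul_comm, ← div_eq_mul_inv]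
    exact ENNReal.div_lt_of_lt_mul (by rwa [one_mul])
  -- Chebyshev's inequality for the exponent `n + 1`
  have hn : ∀ n : ℕ, ν {x | a ≤ ‖f x‖ₑ} ≤ (a⁻¹ * eLpNorm g ∞ ν) ^ (n + 1) * ν univ := by
    intro n
    have hp0 : ((n + 1 : ℕ) : ℝ≥0∞) ≠ 0 := by simp
    have hpt : ((n + 1 : ℕ) : ℝ≥0∞) ≠ ∞ := ENNReal.natCast_ne_top _
    have hp1 : 1 ≤ ((n + 1 : ℕ) : ℝ≥0∞) := by
      exact_mod_cast Nat.succ_le_succ (Nat.zero_le n)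
    have h1 := meas_ge_le_mul_pow_eLpNorm_enorm ν hp0 hpt hf ha0 (fun hc => absurd hc hat)
    have h2 := (h _ hp1 hpt).trans (eLpNorm_le_eLpNorm_mul_rpow_measure_univ le_top hg)
    rw [ENNReal.toReal_natCast, ENNReal.toReal_top, div_zero, sub_zero] at h2
    refine h1.trans ?_
    rw [ENNReal.toReal_natCast, ENNReal.rpow_natCast, ENNReal.rpow_natCast]
    refine (mul_le_mul_right (pow_le_pow_left' h2 _) _).trans (le_of_eq ?_)
    rw [mul_pow, mul_pow, ← ENNReal.rpow_natCast (ν univ ^ _), ← ENNReal.rpow_mul,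
      one_div_mul_cancel (by positivity), ENNReal.rpow_one, mul_assoc]
  have hz : ν {x | a ≤ ‖f x‖ₑ} = 0 := by
    have hlim : Tendsto (fun n : ℕ => (a⁻¹ * eLpNorm g ∞ ν) ^ (n + 1) * ν univ) atTop (𝓝 0) := by
      have := ENNReal.Tendsto.mul_const (b := ν univ)
        ((ENNReal.tendsto_pow_atTop_nhds_zero_of_lt_one hx).comp (tendsto_add_atTop_nat 1))
        (Or.inr (measure_ne_top ν univ))
      simpa using this
    exact le_antisymm (ge_of_tendsto' hlim hn) bot_le
  rw [eLpNorm_exponent_top]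
  refine eLpNormEssSup_le_of_ae_enorm_bound ?_
  have : ∀ᵐ x ∂ν, ¬ a ≤ ‖f x‖ₑ := by
    rwa [ae_iff, show {x | ¬¬ a ≤ ‖f x‖ₑ} = {x | a ≤ ‖f x‖ₑ} by simp]
  exact this.mono fun x hx => (not_le.1 hx).le

/-- The first two derivatives of `(s² + ε)^{p/2} - ε^{p/2}`, a smooth approximation of `|s|^p`. The
second one is written so that its sign for `p ≥ 1` is apparent. -/
theorem hasDerivAt_regularized_pow {p ε : ℝ} (hε : 0 < ε) (s : ℝ) :
    HasDerivAt (fun s : ℝ => (s ^ 2 + ε) ^ (p / 2) - ε ^ (p / 2))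
        (p * s * (s ^ 2 + ε) ^ (p / 2 - 1)) s ∧
      HasDerivAt (fun s : ℝ => p * s * (s ^ 2 + ε) ^ (p / 2 - 1))
        (p * (s ^ 2 + ε) ^ (p / 2 - 2) * ((p - 1) * s ^ 2 + ε)) s := by
  have hpos : 0 < s ^ 2 + ε := by positivity
  have hb : HasDerivAt (fun s : ℝ => s ^ 2 + ε) (2 * s) s := by
    simpa using (hasDerivAt_pow 2 s).add_const ε
  have hp : HasDerivAt (fun s : ℝ => p * s) p s := by
    simpa using (hasDerivAt_id s).const_mul p
  constructor
  · refine ((hb.rpow_const (p := p / 2) (Or.inl hpos.ne')).sub_const (ε ^ (p / 2))).congr_deriv ?_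
    ring
  · refine (hp.mul (hb.rpow_const (p := p / 2 - 1) (Or.inl hpos.ne'))).congr_deriv ?_
    have e : (s ^ 2 + ε) ^ (p / 2 - 1) = (s ^ 2 + ε) ^ (p / 2 - 2) * (s ^ 2 + ε) := by
      rw [← Real.rpow_add_one hpos.ne']
      congr 1; ring
    rw [e, show p / 2 - 1 - 1 = p / 2 - 2 by ring]
    ring

theorem integral_abs_rpow_le_of_integral_convex_le {α : Type*} [MeasurableSpace α] {ν : Measure α}
    [IsFiniteMeasure ν] {f g : α → ℝ} (hfm : AEStronglyMeasurable f ν)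
    (hgm : AEStronglyMeasurable g ν) {A : ℝ} (hf : ∀ᵐ x ∂ν, |f x| ≤ A) (hg : ∀ᵐ x ∂ν, |g x| ≤ A)
    (h : ∀ j β β' : ℝ → ℝ, (∀ s, HasDerivAt j (β s) s) → (∀ s, HasDerivAt β (β' s) s) →
      Continuous β' → (∀ s, 0 ≤ β' s) → j 0 = 0 → β 0 = 0 → ∫ x, j (f x) ∂ν ≤ ∫ x, j (g x) ∂ν)
    {p : ℝ} (hp : 1 ≤ p) : ∫ x, |f x| ^ p ∂ν ≤ ∫ x, |g x| ^ p ∂ν := by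
  have hcont : ∀ ε : ℝ, Continuous fun s : ℝ => (s ^ 2 + ε) ^ (p / 2) := fun ε =>
    (by fun_prop : Continuous fun s : ℝ => s ^ 2 + ε).rpow_const fun _ => Or.inr (by positivity)
  have habs : ∀ s : ℝ, |s| ^ p = (s ^ 2) ^ (p / 2) := fun s => by
    rw [← sq_abs, ← Real.rpow_natCast, ← Real.rpow_mul (abs_nonneg s)]
    congr 1
    push_cast
    ring
  have hbd : ∀ ε, 0 ≤ ε → ε ≤ 1 → ∀ s, |s| ≤ A →
      ‖(s ^ 2 + ε) ^ (p / 2)‖ ≤ (A ^ 2 + 1) ^ (p / 2) := by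
    intro ε h0 h1 s hs
    rw [Real.norm_eq_abs, abs_of_nonneg (by positivity)]
    refine Real.rpow_le_rpow (by positivity) ?_ (by positivity)
    have := sq_le_sq' (by linarith [neg_abs_le s]) ((le_abs_self s).trans hs)
    linarith
  have hint : ∀ ε, 0 ≤ ε → ε ≤ 1 → ∀ {q : α → ℝ}, AEStronglyMeasurable q ν →
      (∀ᵐ x ∂ν, |q x| ≤ A) → Integrable (fun x => (q x ^ 2 + ε) ^ (p / 2)) ν :=
    fun ε h0 h1 q hqm hq => Integrable.of_bound ((hcont ε).comp_aestronglyMeasurable hqm) _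
      (hq.mono fun x hx => hbd ε h0 h1 _ hx)
  have hn1 : ∀ n : ℕ, 1 / ((n : ℝ) + 1) ≤ 1 := fun n => by
    rw [div_le_one (by positivity)]; linarith [(Nat.cast_nonneg n : (0 : ℝ) ≤ n)]
  have hn0 : ∀ n : ℕ, 0 < 1 / ((n : ℝ) + 1) := fun n => by positivity
  have hle : ∀ n : ℕ, ∫ x, |f x| ^ p ∂ν ≤ ∫ x, (g x ^ 2 + 1 / ((n : ℝ) + 1)) ^ (p / 2) ∂ν := by
    intro n
    set ε : ℝ := 1 / ((n : ℝ) + 1) with hε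
    have hε0 : 0 < ε := hn0 n
    have hif := hint ε hε0.le (hn1 n) hfm hf
    have hig := hint ε hε0.le (hn1 n) hgm hg
    have key := h _ _ _ (fun s => (hasDerivAt_regularized_pow (p := p) hε0 s).1)
      (fun s => (hasDerivAt_regularized_pow hε0 s).2)
      (by
        have : Continuous fun s : ℝ => (s ^ 2 + ε) ^ (p / 2 - 2) :=
          (by fun_prop : Continuous fun s : ℝ => s ^ 2 + ε).rpow_const
            fun s => Or.inl (by positivity)
        fun_prop)
      (fun s => by
        have : 0 ≤ p - 1 := by linarith
        positivity) (by simp) (by simp)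
    rw [integral_sub hif (integrable_const _), integral_sub hig (integrable_const _),
      sub_le_sub_iff_right] at key
    refine le_trans (integral_mono_ae ?_ hif (Eventually.of_forall fun x => ?_)) key
    · simpa only [habs, add_zero] using hint 0 le_rfl zero_le_one hfm hf
    · simp only [habs]
      exact Real.rpow_le_rpow (sq_nonneg _) (by linarith) (by positivity)
  refine ge_of_tendsto' (x := atTop) ?_ hle
  simp only [habs]
  refine tendsto_integral_of_dominated_convergence (fun _ => (A ^ 2 + 1) ^ (p / 2))
    (fun n => (hint _ (hn0 n).le (hn1 n) hgm hg).aestronglyMeasurable) (integrable_const _)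
    (fun n => hg.mono fun x hx => hbd _ (hn0 n).le (hn1 n) _ hx)
    (Eventually.of_forall fun x => ?_)
  have hlim : Tendsto (fun n : ℕ => g x ^ 2 + 1 / ((n : ℝ) + 1)) atTop (𝓝 (g x ^ 2)) := by
    simpa using (tendsto_one_div_add_atTop_nhds_zero_nat (𝕜 := ℝ)).const_add (g x ^ 2)
  exact hlim.rpow_const (Or.inr (by positivity))

/-- If all smooth convex integral functionals with minimum at `0` are smaller at `f` than at `g`,
then so are all `L^p` norms, `1 ≤ p ≤ ∞`. -/
theorem eLpNorm_le_of_integral_convex_le {α : Type*} [MeasurableSpace α] {ν : Measure α}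
    [IsFiniteMeasure ν] {f g : α → ℝ} (hfm : AEStronglyMeasurable f ν)
    (hgm : AEStronglyMeasurable g ν) {A : ℝ} (hf : ∀ᵐ x ∂ν, |f x| ≤ A) (hg : ∀ᵐ x ∂ν, |g x| ≤ A)
    (h : ∀ j β β' : ℝ → ℝ, (∀ s, HasDerivAt j (β s) s) → (∀ s, HasDerivAt β (β' s) s) →
      Continuous β' → (∀ s, 0 ≤ β' s) → j 0 = 0 → β 0 = 0 → ∫ x, j (f x) ∂ν ≤ ∫ x, j (g x) ∂ν)
    {p : ℝ≥0∞} (hp : 1 ≤ p) : eLpNorm f p ν ≤ eLpNorm g p ν := by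
  have hfin : ∀ p : ℝ≥0∞, 1 ≤ p → p ≠ ∞ → eLpNorm f p ν ≤ eLpNorm g p ν := by
    intro p hp hpt
    have hp0 : p ≠ 0 := (zero_lt_one.trans_le hp).ne'
    have hp1 : 1 ≤ p.toReal := by
      rw [← ENNReal.toReal_one]
      exact ENNReal.toReal_mono hpt hp
    rw [(MemLp.of_bound hfm A hf).eLpNorm_eq_integral_rpow_norm hp0 hpt,
      (MemLp.of_bound hgm A hg).eLpNorm_eq_integral_rpow_norm hp0 hpt]
    refine ENNReal.ofReal_le_ofReal (Real.rpow_le_rpow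
      (integral_nonneg fun x => by positivity) ?_ (by positivity))
    exact integral_abs_rpow_le_of_integral_convex_le hfm hgm hf hg h hp1
  rcases eq_or_ne p ∞ with rfl | hpt
  · exact eLpNorm_top_le_of_forall_eLpNorm_le hfm hgm hfin
  · exact hfin p hp hpt

end DensityFlow

theorem mainTheorem3 (d : ℕ) (hd : d = 2 ∨ d = 3)
    (Ω : Set (DensityFlow.Space d)) (hΩ : DensityFlow.IsBoundedLipschitzDomain Ω)
    (P : DensityFlow.Params)
    (g : DensityFlow.Space d → DensityFlow.Space d) (hg : MemLp g ∞ (volume.restrict Ω))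
    (κ : DensityFlow.Space d → ℝ) (hκ : MemLp κ 2 (volume.restrict Ω))
    (κ₁ : ℝ) (hκ₁ : 0 < κ₁) (hκ_ge : ∀ᵐ x ∂(volume.restrict Ω), κ₁ ≤ κ x) :
    ∃ (C : ℝ≥0∞ → ℝ) (lam : ℝ),
      (∀ p, 0 < C p) ∧ 0 < lam ∧ lam = κ₁ / (1 + P.k) ∧
      ∀ (c₀ : DensityFlow.Space d → ℝ) (M₂ : ℝ),
        AEStronglyMeasurable c₀ (volume.restrict Ω) →
        (∀ᵐ x ∂(volume.restrict Ω), 0 ≤ c₀ x ∧ c₀ x ≤ M₂) →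
        ∀ (c : ℝ → DensityFlow.L2 Ω) (u : ℝ → DensityFlow.L2Vec Ω),
          DensityFlow.IsWeakSolution Ω P g κ c₀ c u →
          ∀ t : ℝ, 0 ≤ t → ∀ p : ℝ≥0∞, 1 ≤ p →
            eLpNorm (c t) p (volume.restrict Ω)
              ≤ ENNReal.ofReal (C p * Real.exp (-lam * t))
                * eLpNorm c₀ p (volume.restrict Ω) := by
  have hk1 : 0 < 1 + P.k := by linarith [P.k_nonneg]
  refine ⟨fun _ => 1, κ₁ / (1 + P.k), fun _ => one_pos, by positivity, rfl, ?_⟩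
  rintro c₀ M₂ hc₀m hc₀ c u ⟨cH, c', hs⟩ t ht p hp
  have hfin : volume Ω ≠ ∞ := hΩ.isBounded.measure_lt_top.ne
  have : IsFiniteMeasure (volume.restrict Ω) := ⟨by simpa using hfin.lt_top⟩
  rcases ht.eq_or_lt with rfl | ht
  · simp [eLpNorm_congr_ae hs.initial]
  set lam : ℝ := κ₁ / (1 + P.k) with hlam
  have hc₀b : ∀ᵐ x ∂(volume.restrict Ω), |c₀ x| ≤ M₂ := hc₀.mono fun x hx => by
    rw [abs_of_nonneg hx.1]; exact hx.2
  obtain ⟨A, hA, hconv⟩ := hs.integral_convex_le hΩ.isOpen hfin hκ hκ₁ hκ_ge hc₀b hlam ht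
  have key := DensityFlow.eLpNorm_le_of_integral_convex_le (A := max A M₂)
    (Lp.memLp (Real.exp (lam * t) • c t)).1 hc₀m
    (hA.mono fun x hx => hx.trans (le_max_left _ _))
    (hc₀b.mono fun x hx => hx.trans (le_max_right _ _)) hconv hp
  have e : eLpNorm (c t) p (volume.restrict Ω) = ENNReal.ofReal (Real.exp (-lam * t))
      * eLpNorm (Real.exp (lam * t) • c t : DensityFlow.L2 Ω) p (volume.restrict Ω) := by
    rw [eLpNorm_congr_ae (Lp.coeFn_smul (Real.exp (lam * t)) (c t)), eLpNorm_const_smul,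
      ← ofReal_norm, ← mul_assoc, ← ENNReal.ofReal_mul (Real.exp_pos _).le, Real.norm_eq_abs,
      Real.abs_exp, ← Real.exp_add]
    simp
  rw [e, one_mul]
  gcongr
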